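/- Let $1<p<\infty$, $1/p+1/q=1$, and let $\mathbb T$ be the unit circle with normalized Lebesgue measure; equalities of functions hold almost everywhere, and $f_n$ ($n\in\mathbb Z$) denotes the Fourier coefficients of $f$. Let $H^p(\mathbb T)=\{f\in L^p(\mathbb T): f_n=0 \text{ for all } n<0\}$, $\overline{H^p(\mathbb T)}=\{f:\overline f\in H^p(\mathbb T)\}$, and let $L^p_{\rm even}(\mathbb T)$ be the set of $f\in L^p(\mathbb T)$ with $f(t)=f(t^{-1})$. Let $P:\sum_{n\in\mathbb Z}f_nt^n\mapsto\sum_{n\ge0}f_nt^n$ be the Riesz projection, $(Jf)(t)=t^{-1}f(t^{-1})$, $L(\psi)f=\psi f$, and $L^p_J(\mathbb T)=\{f\in L^p(\mathbb T):Jf=f\}$. Let $\phi\in GL^\infty(\mathbb T)$, i.e. let $\phi$ be an invertible element of the Banach algebra $L^\infty(\mathbb T)$. For $\kappa\in\mathbb Z$, we say that $\phi$ admits an asymmetric factorization in $L^p(\mathbb T)$ with index $\kappa$ if there are functions $\phi_-,\phi_0$ on $\mathbb T$ with $\phi(t)=\phi_-(t)\,t^{\kappa}\,\phi_0(t)$ such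 that (i) $(1+t^{-1})\phi_-\in\overline{H^p(\mathbb T)}$ and $(1-t^{-1})\phi_-^{-1}\in\overline{H^q(\mathbb T)}$; (ii) $|1-t|\,\phi_0\in L^q_{\rm even}(\mathbb T)$ and $|1+t|\,\phi_0^{-1}\in L^p_{\rm even}(\mathbb T)$; (iii) the operator $B=L(\phi_0^{-1})(I+J)P\,L(\phi_-^{-1})$, defined on the dense subspace $X_1=\{(1-t^{-1})r(t): r \text{ a trigonometric polynomial}\}$ of $L^p(\mathbb T)$, extends to a bounded linear operator from $L^p(\mathbb T)$ into $L^p_J(\mathbb T)$. Theorem. Let $\phi\in GL^\infty(\mathbb T)$. The Toeplitz operator $T(\phi):f\mapsto P(\phi f)$ and the Hankel operator $H(\phi):f\mapsto P(\phi\,(Jf))$ are well-defined bounded linear operators on $H^p(\mathbb T)$, and $M(\phi)=T(\phi)+H(\phi)$ is invertible on $H^p(\mathbb T)$ if and only if $\phi$ admits an asymmetric factorization in $L^p(\mathbb T)$ with index $\kappa=0$. -/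

import Mathlib

open MeasureTheory AddCircle
open scoped ENNReal

namespace AsymFact

/-- The unit circle, parametrized by `x ↦ t = exp (2 π i x)`: the coordinate function `t` is
`fourier 1`, its power `t ^ n` is `fourier n`, and `x ↦ -x` is the substitution `t ↦ t⁻¹`. -/
abbrev Circ : Type := UnitAddCircle

/-- Normalized Lebesgue (Haar) measure on the circle. -/
noncomputable abbrev circMeasure : Measure Circ := haarAddCircle

/-- The monomial `t ^ n`. -/
noncomputable abbrev tpow (n : ℤ) (x : Circ) : ℂ := fourier n x

/-- Trigonometric polynomials. -/
noncomputable def trigPoly : Submodule ℂ C(Circ, ℂ) :=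
  Submodule.span ℂ (Set.range (fun n : ℤ => (fourier n : C(Circ, ℂ))))

/-- `φ` represents an invertible element of the Banach algebra `L^∞`. -/
def IsUnitLinfty (φ : Circ → ℂ) : Prop :=
  MemLp φ ∞ circMeasure ∧
    ∃ ψ : Circ → ℂ, MemLp ψ ∞ circMeasure ∧ ∀ᵐ x ∂circMeasure, φ x * ψ x = 1

/-- Evenness, `f(t) = f(t⁻¹)` for almost all `t`. -/
def IsEven (f : Circ → ℂ) : Prop := ∀ᵐ x ∂circMeasure, f (-x) = f x

/-- `f` represents an element of `L^p_even`. -/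
def MemLpEven (p : ℝ≥0∞) (f : Circ → ℂ) : Prop := MemLp f p circMeasure ∧ IsEven f

/-- `f` represents an element of the Hardy space `H^p`. -/
def MemHardy (p : ℝ≥0∞) (f : Circ → ℂ) : Prop :=
  MemLp f p circMeasure ∧ ∀ n : ℤ, n < 0 → fourierCoeff f n = 0

/-- `f` represents an element of the complex conjugate Hardy space. -/
def MemConjHardy (p : ℝ≥0∞) (f : Circ → ℂ) : Prop :=
  MemHardy p (fun x => starRingEnd ℂ (f x))

/-- The flip `(J f)(t) = t⁻¹ f(t⁻¹)`. -/
noncomputable def flip (f : Circ → ℂ) (x : Circ) : ℂ := tpow (-1) x * f (-x)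

/-- `g = P f`, with `P : ∑_{n ∈ ℤ} fₙ tⁿ ↦ ∑_{n ≥ 0} fₙ tⁿ` the Riesz projection. -/
def IsRieszProjection (f g : Circ → ℂ) : Prop :=
  Integrable f circMeasure ∧ Integrable g circMeasure ∧
    ∀ n : ℤ, fourierCoeff g n = if 0 ≤ n then fourierCoeff f n else 0

theorem integrable_coe (p : ℝ≥0∞) [hp : Fact (1 ≤ p)] (f : Lp ℂ p circMeasure) :
    Integrable (f : Circ → ℂ) circMeasure :=
  (Lp.memLp f).integrable hp.out

theorem fourierCoeff_congr {f g : Circ → ℂ} (h : f =ᵐ[circMeasure] g) (n : ℤ) :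
    fourierCoeff f n = fourierCoeff g n := by
  unfold fourierCoeff
  refine integral_congr_ae ?_
  filter_upwards [h] with x hx
  rw [hx]

/-- The Hardy space `H^p` as a subspace of `L^p`, with the `L^p` norm. -/
noncomputable def Hardy (p : ℝ≥0∞) [Fact (1 ≤ p)] : Submodule ℂ (Lp ℂ p circMeasure) where
  carrier := {f | MemHardy p (f : Circ → ℂ)}
  zero_mem' := by
    refine ⟨Lp.memLp _, fun n _ => ?_⟩
    rw [fourierCoeff_congr (Lp.coeFn_zero ℂ p circMeasure) n]
    simp [fourierCoeff]
  add_mem' := by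
    intro f g hf hg
    refine ⟨Lp.memLp _, fun n hn => ?_⟩
    rw [fourierCoeff_congr (Lp.coeFn_add f g) n,
      fourierCoeff.add (integrable_coe p f) (integrable_coe p g)]
    simp [hf.2 n hn, hg.2 n hn]
  smul_mem' := by
    intro c f hf
    refine ⟨Lp.memLp _, fun n hn => ?_⟩
    rw [fourierCoeff_congr (Lp.coeFn_smul c f) n, fourierCoeff.const_smul]
    simp [hf.2 n hn]

theorem ae_neg {q : Circ → Prop} (h : ∀ᵐ x ∂circMeasure, q x) :
    ∀ᵐ x ∂circMeasure, q (-x) :=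
  (Measure.measurePreserving_neg circMeasure).quasiMeasurePreserving.ae h

/-- The subspace `L^p_J = {f ∈ L^p : J f = f}`, which is the image of `(I + J) / 2`. -/
noncomputable def LpJ (p : ℝ≥0∞) [Fact (1 ≤ p)] : Submodule ℂ (Lp ℂ p circMeasure) where
  carrier := {f | ∀ᵐ x ∂circMeasure, flip f x = f x}
  zero_mem' := by
    have h := Lp.coeFn_zero ℂ p circMeasure
    change ∀ᵐ x ∂circMeasure, flip _ x = _
    filter_upwards [h, ae_neg h] with x h1 h2
    simp only [flip]
    rw [h1, h2, Pi.zero_apply, Pi.zero_apply, mul_zero]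
  add_mem' := by
    intro f g hf hg
    have h := Lp.coeFn_add f g
    change ∀ᵐ x ∂circMeasure, flip _ x = _
    filter_upwards [h, ae_neg h, hf, hg] with x h1 h2 h3 h4
    simp only [flip] at h3 h4 ⊢
    rw [h1, h2, Pi.add_apply, Pi.add_apply, mul_add, h3, h4]
  smul_mem' := by
    intro c f hf
    have h := Lp.coeFn_smul c f
    change ∀ᵐ x ∂circMeasure, flip _ x = _
    filter_upwards [h, ae_neg h, hf] with x h1 h2 h3
    simp only [flip] at h3 ⊢
    rw [h1, h2, Pi.smul_apply, Pi.smul_apply, mul_smul_comm, h3]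

/-- `T` is the Toeplitz operator `T(φ) : f ↦ P(φ f)` on `H^p`. -/
def IsToeplitz {p : ℝ≥0∞} [Fact (1 ≤ p)] (φ : Circ → ℂ) (T : Hardy p →L[ℂ] Hardy p) : Prop :=
  ∀ f : Hardy p, IsRieszProjection
    (fun x => φ x * (f : Lp ℂ p circMeasure) x) ((T f : Lp ℂ p circMeasure) : Circ → ℂ)

/-- `H` is the Hankel operator `H(φ) : f ↦ P(φ (J f))` on `H^p`. -/
def IsHankel {p : ℝ≥0∞} [Fact (1 ≤ p)] (φ : Circ → ℂ) (H : Hardy p →L[ℂ] Hardy p) : Prop :=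
  ∀ f : Hardy p, IsRieszProjection
    (fun x => φ x * flip (f : Lp ℂ p circMeasure) x) ((H f : Lp ℂ p circMeasure) : Circ → ℂ)

/-- `h = B f` for the formal inverse `B = L(φ₀⁻¹) (I + J) P L(φ₋⁻¹)`. -/
def IsFormalInverse (φm φ₀ f h : Circ → ℂ) : Prop :=
  ∃ g : Circ → ℂ, IsRieszProjection (fun x => (φm x)⁻¹ * f x) g ∧
    ∀ᵐ x ∂circMeasure, h x = (φ₀ x)⁻¹ * (g x + flip g x)

/-- `φ = φ₋ t ^ κ φ₀` is an asymmetric factorization in `L^p`; here `1/p + 1/q = 1`. -/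
structure IsAsymmetricFactorization (p q : ℝ≥0∞) [Fact (1 ≤ p)]
    (φ φm : Circ → ℂ) (κ : ℤ) (φ₀ : Circ → ℂ) : Prop where
  eq : ∀ᵐ x ∂circMeasure, φ x = φm x * tpow κ x * φ₀ x
  minus : MemConjHardy p (fun x => (1 + tpow (-1) x) * φm x)
  minus_inv : MemConjHardy q (fun x => (1 - tpow (-1) x) * (φm x)⁻¹)
  even : MemLpEven q (fun x => (‖1 - tpow 1 x‖ : ℂ) * φ₀ x)
  even_inv : MemLpEven p (fun x => (‖1 + tpow 1 x‖ : ℂ) * (φ₀ x)⁻¹)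
  /-- `B`, defined on `X₁ = {(1 - t⁻¹) r : r a trigonometric polynomial}`, extends to a bounded
  linear operator from `L^p` into `L^p_J`. -/
  bounded : ∃ B : Lp ℂ p circMeasure →L[ℂ] LpJ p,
    ∀ r ∈ trigPoly, ∀ f : Lp ℂ p circMeasure,
      (∀ᵐ x ∂circMeasure, f x = (1 - tpow (-1) x) * r x) →
        IsFormalInverse φm φ₀ f ((B f : Lp ℂ p circMeasure) : Circ → ℂ)

/-- `φ` admits an asymmetric factorization in `L^p` with index `κ`. -/
def AdmitsAsymmetricFactorization (p q : ℝ≥0∞) [Fact (1 ≤ p)] (φ : Circ → ℂ) (κ : ℤ) : Prop :=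
  ∃ φm φ₀ : Circ → ℂ, IsAsymmetricFactorization p q φ φm κ φ₀

end AsymFact

/-!
The theorem rests on the observation that `I + J` maps `H^p` bijectively onto `L^p_J`, with inverse
`P`, so that `T(φ) + H(φ)` is equivalent to `Φ : L^p_J → H^p`, `Φ h = P (φ h)`
(`fourierCoeff_toeplitz_add_hankel`, `LpJ_eq_add_flip`).

*Boundedness of `P`.* For a positive trigonometric polynomial `u = Re F`, with `F` analytic, and
`1 < p ≤ 2`, the inequality `|z| ^ p ≤ A (Re z) ^ p - B Re (z ^ p)` on the right half plane and the
mean value property of `F ^ p` bound `‖F‖_p` by `‖u‖_p` (`integral_analyticPart_le`). General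
trigonometric polynomials are combinations of positive ones up to a uniformly small error, and
`p > 2` follows from the representation of functionals on `L^q`, which is derived here from the
Radon–Nikodym theorem (`exists_memLp_representation`, `exists_rieszCLM`).

*Factorization implies invertibility.* Let `φ = φ₋ φ₀`. For `f ∈ X₁` the difference
`f - φ B f = φ₋ (φ₋⁻¹ f - (I + J) P φ₋⁻¹ f)` becomes coanalytic with mean zero after multiplication
by `1 + t⁻¹`, hence is so itself by the Riemann–Lebesgue lemma; thus `Φ B f = P f`, and this extends
from the dense set `X₁` (`fourierCoeff_mul_formalInverse`). If `Φ h = 0`, then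
`b = (1 - t⁻¹) φ₀ h = (1 - t⁻¹) φ₋⁻¹ (φ h)` has only negative frequencies and satisfies
`b(t⁻¹) = -t² b(t)`, so `b = 0` (`eq_zero_of_mem_LpJ`).

*Invertibility implies factorization.* Solve `Φ h₀ = 1`. Dually, represent a functional by
`g ∈ t + conj H^q` such that `k = φ g` annihilates `L^p_J`, i.e. `k(t⁻¹) = -t⁻¹ k(t)`
(`exists_dual_solution`). The product `h₀ k = (φ h₀) g` is odd with top term `t`, so it equals
`t - t⁻¹` (`mul_dual_solution`). Then `φ₋ = φ h₀ / (1 + t⁻¹)` and `φ₀ = (1 + t⁻¹) / h₀` have the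
required integrability, and `B` is the restriction to `X₁` of `Φ⁻¹ P`
(`isFormalInverse_of_inverse_operator`).
-/

namespace AsymFact

open Filter Topology Complex

/-! ### Duality of `L^p` spaces -/

section Duality

variable {Ω : Type*} [MeasurableSpace Ω] {μ : Measure Ω}

/-- Multiplication by an `L^∞` function, as an operator on `L^p`. -/
noncomputable def mulCLM (p : ℝ≥0∞) [Fact (1 ≤ p)] {h : Ω → ℂ} (hh : MemLp h ∞ μ) :
    Lp ℂ p μ →L[ℂ] Lp ℂ p μ :=
  (ContinuousLinearMap.mul ℂ ℂ).holderL μ ∞ p p hh.toLp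

theorem coeFn_mulCLM {p : ℝ≥0∞} [Fact (1 ≤ p)] {h : Ω → ℂ} (hh : MemLp h ∞ μ) (f : Lp ℂ p μ) :
    mulCLM p hh f =ᵐ[μ] fun x => h x * f x := by
  refine ((ContinuousLinearMap.mul ℂ ℂ).coeFn_holder (r := p) hh.toLp f).trans ?_
  filter_upwards [hh.coeFn_toLp] with x hx
  simp [hx]

/-- The bounded functional `f ↦ ∫ f g` on `L^p` given by `g` in the conjugate space `L^q`. -/
noncomputable def pairCLM (p : ℝ≥0∞) {q : ℝ≥0∞} [Fact (1 ≤ p)] [Fact (1 ≤ q)]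
    [ENNReal.HolderConjugate p q] {g : Ω → ℂ} (hg : MemLp g q μ) : Lp ℂ p μ →L[ℂ] ℂ :=
  ((ContinuousLinearMap.mul ℂ ℂ).lpPairing μ p q).flip hg.toLp

theorem pairCLM_apply {p q : ℝ≥0∞} [Fact (1 ≤ p)] [Fact (1 ≤ q)]
    [ENNReal.HolderConjugate p q] {g : Ω → ℂ} (hg : MemLp g q μ) (f : Lp ℂ p μ) :
    pairCLM p hg f = ∫ x, f x * g x ∂μ := by
  simp only [pairCLM, ContinuousLinearMap.flip_apply, ContinuousLinearMap.lpPairing_eq_integral]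
  refine integral_congr_ae ?_
  filter_upwards [hg.coeFn_toLp] with x hx
  simp [hx]

/-- The `L^q` norm is attained on the pairing with `L^p`: the extremal function for `h` is
`conj h * |h| ^ (q - 2)`. -/
theorem eLpNorm_le_of_pairing_le {p q : ℝ≥0∞} [Fact (1 ≤ p)] [ENNReal.HolderConjugate p q]
    (hp1 : 1 < p) (hp : p < ∞) {h : Ω → ℂ} (hh : MemLp h q μ) {C : ℝ}
    (hC : ∀ f : Lp ℂ p μ, ‖∫ x, f x * h x ∂μ‖ ≤ C * ‖f‖) : eLpNorm h q μ ≤ ENNReal.ofReal C := by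
  have hq1 : 1 < q := (ENNReal.HolderConjugate.lt_top_iff_one_lt p q).1 hp
  have hq : q < ∞ := (ENNReal.HolderConjugate.lt_top_iff_one_lt q p).2 hp1
  set r := q.toReal with hr
  set s := p.toReal with hs
  have hconj : s.HolderConjugate r := ENNReal.HolderConjugate.toReal_of_ne_top hp.ne hq.ne
  have hr1 : 1 < r := hconj.symm.lt
  have hs1 : 1 < s := hconj.lt
  set J : ℝ≥0∞ := ∫⁻ x, ‖h x‖ₑ ^ r ∂μ with hJ
  have hJtop : J < ∞ := by
    have := lintegral_rpow_enorm_lt_top_of_eLpNorm_lt_top (by positivity) hq.ne hh.2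
    exact this
  have hmul : (r - 1) * s = r := by
    have := hconj.symm.sub_one_mul_conj
    linarith
  set f : Ω → ℂ := fun x => (starRingEnd ℂ) (h x) * ((‖h x‖ ^ (r - 2) : ℝ) : ℂ) with hf
  have hfm : AEStronglyMeasurable f μ := by
    refine (continuous_conj.comp_aestronglyMeasurable hh.1).mul ?_
    exact (continuous_ofReal.measurable.comp_aemeasurable
      (hh.1.norm.aemeasurable.pow_const _)).aestronglyMeasurable
  have hfn : ∀ x, ‖f x‖ = ‖h x‖ ^ (r - 1) := by
    intro x
    rcases eq_or_ne (h x) 0 with h0 | h0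
    · simp [hf, h0, Real.zero_rpow (by linarith : r - 1 ≠ 0)]
    · have : 0 < ‖h x‖ := norm_pos_iff.2 h0
      simp only [hf, norm_mul, RCLike.norm_conj, norm_real, Real.norm_eq_abs,
        abs_of_nonneg (Real.rpow_nonneg this.le _)]
      rw [← Real.rpow_one_add' this.le (by linarith)]
      congr 1; ring
  have hfe : ∀ x, ‖f x‖ₑ ^ s = ‖h x‖ₑ ^ r := by
    intro x
    rw [← ofReal_norm, ← ofReal_norm, hfn,
      ENNReal.ofReal_rpow_of_nonneg (by positivity) (by linarith),
      ENNReal.ofReal_rpow_of_nonneg (by positivity) (by linarith),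
      ← Real.rpow_mul (norm_nonneg _), hmul]
  have hfh : ∀ x, f x * h x = ((‖h x‖ ^ r : ℝ) : ℂ) := by
    intro x
    rcases eq_or_ne (h x) 0 with h0 | h0
    · simp [h0, Real.zero_rpow (by linarith : r ≠ 0)]
    · have : 0 < ‖h x‖ := norm_pos_iff.2 h0
      have e : f x * h x = (h x * (starRingEnd ℂ) (h x)) * ((‖h x‖ ^ (r - 2) : ℝ) : ℂ) := by
        simp only [hf]; ring
      rw [e, Complex.mul_conj, Complex.normSq_eq_norm_sq, ← ofReal_mul, ← Real.rpow_natCast,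
        ← Real.rpow_add this]
      norm_num
  have hfp : eLpNorm f p μ = J ^ (1 / s) := by
    rw [eLpNorm_eq_lintegral_rpow_enorm_toReal (by positivity) hp.ne]
    simp only [← hs, hfe, hJ]
  have hfL : MemLp f p μ :=
    ⟨hfm, hfp ▸ ENNReal.rpow_lt_top_of_nonneg (by positivity) hJtop.ne⟩
  have key := hC hfL.toLp
  have e1 : ∫ x, hfL.toLp f x * h x ∂μ = ((J.toReal : ℝ) : ℂ) := by
    calc ∫ x, hfL.toLp f x * h x ∂μ = ∫ x, ((‖h x‖ ^ r : ℝ) : ℂ) ∂μ := by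
          refine integral_congr_ae ?_
          filter_upwards [hfL.coeFn_toLp] with x hx
          rw [hx, hfh]
      _ = ((J.toReal : ℝ) : ℂ) := by
          rw [integral_complex_ofReal, integral_eq_lintegral_of_nonneg_ae
            (Eventually.of_forall fun x => by positivity)
            (hh.1.norm.aemeasurable.pow_const _).aestronglyMeasurable]
          simp only [hJ]
          congr 3
          funext x
          rw [← ofReal_norm, ENNReal.ofReal_rpow_of_nonneg (by positivity) (by linarith)]
  rw [e1, Lp.norm_toLp, hfp, norm_real, Real.norm_eq_abs, abs_of_nonneg ENNReal.toReal_nonneg,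
    ← ENNReal.toReal_rpow] at key
  have hgoal : eLpNorm h q μ = J ^ (1 / r) := by
    rw [eLpNorm_eq_lintegral_rpow_enorm_toReal (by positivity) hq.ne]
  rw [hgoal]
  rcases eq_or_ne J 0 with h0 | h0
  · rw [h0, ENNReal.zero_rpow_of_pos (by positivity)]
    exact zero_le
  · have hpos : 0 < J.toReal := ENNReal.toReal_pos h0 hJtop.ne
    rw [← ENNReal.ofReal_toReal (ENNReal.rpow_ne_top_of_nonneg (by positivity) hJtop.ne),
      ← ENNReal.toReal_rpow]
    refine ENNReal.ofReal_le_ofReal ?_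
    have h2 : J.toReal = J.toReal ^ (1 / r) * J.toReal ^ (1 / s) := by
      rw [← Real.rpow_add hpos, one_div, one_div, add_comm, hconj.inv_add_inv_eq_one,
        Real.rpow_one]
    have h3 : J.toReal ^ (1 / r) * J.toReal ^ (1 / s) ≤ C * J.toReal ^ (1 / s) := by
      rw [← h2]; exact key
    exact le_of_mul_le_mul_right h3 (by positivity)

variable [IsFiniteMeasure μ]

theorem hasSum_indicatorConstLp {p : ℝ≥0∞} [Fact (1 ≤ p)] (hp : p ≠ ∞) {A : ℕ → Set Ω}
    (hA : ∀ i, MeasurableSet (A i)) (hd : Pairwise (Function.onFun Disjoint A)) :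
    HasSum (fun i => indicatorConstLp p (hA i) (measure_ne_top μ (A i)) (1 : ℂ))
      (indicatorConstLp p (MeasurableSet.iUnion hA) (measure_ne_top μ _) (1 : ℂ)) := by
  have hm : ∀ s : Finset ℕ, MeasurableSet (⋃ i ∈ s, A i) := fun s =>
    Finset.measurableSet_biUnion s fun i _ => hA i
  have key : ∀ s : Finset ℕ, ∑ i ∈ s, indicatorConstLp p (hA i) (measure_ne_top μ (A i)) (1 : ℂ)
      = indicatorConstLp p (hm s) (measure_ne_top μ _) (1 : ℂ) := by
    classical
    intro s
    induction s using Finset.induction_on with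
    | empty => simp [indicatorConstLp_empty]
    | insert i s hi ih =>
      rw [Finset.sum_insert hi, ih, ← indicatorConstLp_disjoint_union]
      · simp
      · rw [Set.disjoint_iUnion₂_right]
        intro j hj
        exact hd (fun h => hi (h ▸ hj))
  rw [HasSum]
  simp only [key]
  refine tendsto_indicatorConstLp_set hp ?_
  have h0 : (⋂ s : Finset ℕ, (⋃ i, A i) \ ⋃ i ∈ s, A i) = ∅ := by
    ext x
    simp only [Set.mem_iInter, Set.mem_sdiff, Set.mem_iUnion, Set.mem_empty_iff_false, iff_false]
    intro h
    obtain ⟨⟨i, hi⟩, _⟩ := h ∅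
    exact (h {i}).2 ⟨i, by simp, hi⟩
  have h1 := tendsto_measure_iInter_atTop (μ := μ)
    (s := fun s : Finset ℕ => (⋃ i, A i) \ ⋃ i ∈ s, A i)
    (fun s => ((MeasurableSet.iUnion hA).diff (hm s)).nullMeasurableSet)
    (fun s t hst => Set.sdiff_subset_sdiff_right (Set.biUnion_subset_biUnion_left hst))
    ⟨∅, measure_ne_top μ _⟩
  rw [h0, measure_empty] at h1
  refine h1.congr fun s => ?_
  rw [Set.symmDiff_def, Set.sdiff_eq_empty.2 (Set.iUnion₂_subset_iUnion _ _)]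
  simp

open Classical in
/-- The complex measure `E ↦ ℓ (1_E)` of a bounded functional `ℓ` on `L^p`, `p < ∞`. -/
noncomputable def functionalMeasure {p : ℝ≥0∞} [Fact (1 ≤ p)] (hp : p ≠ ∞)
    (l : Lp ℂ p μ →L[ℂ] ℂ) : ComplexMeasure Ω where
  measureOf' s := if hs : MeasurableSet s then
    l (indicatorConstLp p hs (measure_ne_top μ s) 1) else 0
  empty' := by simp [indicatorConstLp_empty]
  not_measurable' s hs := by simp [hs]
  m_iUnion' A hA hd := by
    simp only [hA, MeasurableSet.iUnion hA, dif_pos]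
    exact l.hasSum (hasSum_indicatorConstLp hp hA hd)

theorem functionalMeasure_apply {p : ℝ≥0∞} [Fact (1 ≤ p)] (hp : p ≠ ∞)
    (l : Lp ℂ p μ →L[ℂ] ℂ) {s : Set Ω} (hs : MeasurableSet s) :
    functionalMeasure hp l s = l (indicatorConstLp p hs (measure_ne_top μ s) 1) := by
  exact dif_pos hs

/-- On indicators, a bounded functional on `L^p` is integration against an `L^1` density, by the
Radon–Nikodym theorem. -/
theorem exists_integrable_density {p : ℝ≥0∞} [Fact (1 ≤ p)] (hp : p ≠ ∞)
    (l : Lp ℂ p μ →L[ℂ] ℂ) :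
    ∃ g : Ω → ℂ, Integrable g μ ∧ ∀ (s : Set Ω) (hs : MeasurableSet s),
      l (indicatorConstLp p hs (measure_ne_top μ s) 1) = ∫ x in s, g x ∂μ := by
  set ν := functionalMeasure hp l
  have hac : ∀ s, μ s = 0 → ν s = 0 := by
    intro s h
    by_cases hs : MeasurableSet s
    · rw [functionalMeasure_apply hp l hs]
      have : indicatorConstLp p hs (measure_ne_top μ s) (1 : ℂ) = 0 := by
        refine Lp.ext (indicatorConstLp_coeFn.trans ?_)
        refine (indicator_meas_zero h).trans (Lp.coeFn_zero ℂ p μ).symm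
      rw [this, map_zero]
    · exact ν.not_measurable hs
  have hre := SignedMeasure.withDensityᵥ_rnDeriv_eq (ComplexMeasure.re ν) μ (by
    refine VectorMeasure.AbsolutelyContinuous.mk fun s hs h => ?_
    rw [Measure.toENNRealVectorMeasure_apply_measurable hs] at h
    change (ν s).re = 0
    rw [hac s h, Complex.zero_re])
  have him := SignedMeasure.withDensityᵥ_rnDeriv_eq (ComplexMeasure.im ν) μ (by
    refine VectorMeasure.AbsolutelyContinuous.mk fun s hs h => ?_
    rw [Measure.toENNRealVectorMeasure_apply_measurable hs] at h
    change (ν s).im = 0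
    rw [hac s h, Complex.zero_im])
  have i1 := SignedMeasure.integrable_rnDeriv (ComplexMeasure.re ν) μ
  have i2 := SignedMeasure.integrable_rnDeriv (ComplexMeasure.im ν) μ
  refine ⟨fun x => ((ComplexMeasure.re ν).rnDeriv μ x : ℂ) +
    ((ComplexMeasure.im ν).rnDeriv μ x : ℂ) * I, i1.ofReal.add (i2.ofReal.mul_const I),
    fun s hs => ?_⟩
  have e : ∫ x in s, (((ComplexMeasure.re ν).rnDeriv μ x : ℂ) +
      ((ComplexMeasure.im ν).rnDeriv μ x : ℂ) * I) ∂μ =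
      ((∫ x in s, (ComplexMeasure.re ν).rnDeriv μ x ∂μ : ℝ) : ℂ) +
        ((∫ x in s, (ComplexMeasure.im ν).rnDeriv μ x ∂μ : ℝ) : ℂ) * I := by
    have j1 : Integrable (fun x => ((ComplexMeasure.re ν).rnDeriv μ x : ℂ)) (μ.restrict s) :=
      i1.restrict.ofReal
    have j2 : Integrable (fun x => ((ComplexMeasure.im ν).rnDeriv μ x : ℂ)) (μ.restrict s) :=
      i2.restrict.ofReal
    rw [integral_add j1 (j2.mul_const I), integral_mul_const, integral_complex_ofReal,
    integral_complex_ofReal]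
  rw [e, ← withDensityᵥ_apply i1 hs, ← withDensityᵥ_apply i2 hs, hre, him,
    ← functionalMeasure_apply hp l hs]
  exact (Complex.re_add_im _).symm

/-- Two bounded functionals on `L^p` that agree on indicators are equal. -/
theorem functional_ext {p : ℝ≥0∞} [Fact (1 ≤ p)] (hp : p ≠ ∞) {l m : Lp ℂ p μ →L[ℂ] ℂ}
    (h : ∀ (s : Set Ω) (hs : MeasurableSet s),
      l (indicatorConstLp p hs (measure_ne_top μ s) 1) =
        m (indicatorConstLp p hs (measure_ne_top μ s) 1)) : l = m := by
  ext f
  refine Lp.induction hp (fun f => l f = m f) ?_ ?_ (isClosed_eq l.continuous m.continuous) f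
  · intro c s hs hμ
    have : ((Lp.simpleFunc.indicatorConst p hs hμ.ne c : Lp.simpleFunc ℂ p μ) : Lp ℂ p μ)
        = c • indicatorConstLp p hs (measure_ne_top μ s) 1 := by
      rw [Lp.simpleFunc.coe_indicatorConst]
      refine Lp.ext ?_
      filter_upwards [indicatorConstLp_coeFn (p := p) (hs := hs) (hμs := hμ.ne) (c := c),
        Lp.coeFn_smul c (indicatorConstLp p hs (measure_ne_top μ s) (1 : ℂ)),
        indicatorConstLp_coeFn (p := p) (hs := hs) (hμs := measure_ne_top μ s) (c := (1 : ℂ))]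
        with x h1 h2 h3
      rw [h1, h2, Pi.smul_apply, h3]
      by_cases hx : x ∈ s <;> simp [hx]
    rw [this, map_smul, map_smul, h]
  · intro f g hf hg _ h1 h2
    simp only [map_add, h1, h2]

/-- Every bounded functional on `L^p`, `1 < p < ∞`, over a finite measure is integration against a
function in the conjugate space `L^q`. -/
theorem exists_memLp_representation {p q : ℝ≥0∞} [Fact (1 ≤ p)] [ENNReal.HolderConjugate p q]
    (hp1 : 1 < p) (hp : p < ∞) (l : Lp ℂ p μ →L[ℂ] ℂ) :
    ∃ g : Ω → ℂ, MemLp g q μ ∧ ∀ f : Lp ℂ p μ, l f = ∫ x, f x * g x ∂μ := by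
  have hq1 : 1 < q := (ENNReal.HolderConjugate.lt_top_iff_one_lt p q).1 hp
  have : Fact (1 ≤ q) := ⟨hq1.le⟩
  obtain ⟨g₀, hg₀, hl₀⟩ := exists_integrable_density hp.ne l
  obtain ⟨g, hgm, hgg⟩ := hg₀.1
  have hgi : Integrable g μ := hg₀.congr hgg
  have hl : ∀ (s : Set Ω) (hs : MeasurableSet s),
      l (indicatorConstLp p hs (measure_ne_top μ s) 1) = ∫ x in s, g x ∂μ := fun s hs => by
    rw [hl₀ s hs]
    exact integral_congr_ae (ae_restrict_of_ae hgg)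
  -- The truncations of `g` are bounded, and represent the restrictions of `l`.
  set A : ℕ → Set Ω := fun n => {x | ‖g x‖ ≤ n} with hA
  have hAm : ∀ n, MeasurableSet (A n) := fun n =>
    measurableSet_le hgm.norm.measurable measurable_const
  have hgn : ∀ n, MemLp ((A n).indicator g) ∞ μ := fun n =>
    memLp_top_of_bound (hgm.indicator (hAm n)).aestronglyMeasurable n
      (Eventually.of_forall fun x => by
        by_cases hx : x ∈ A n
        · rw [Set.indicator_of_mem hx]
          exact hx
        · simp [hx])
  have hone : ∀ n, MemLp ((A n).indicator fun _ => (1 : ℂ)) ∞ μ := fun n =>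
    (memLp_const 1).indicator (hAm n)
  have hgq : ∀ n, MemLp ((A n).indicator g) q μ := fun n => (hgn n).mono_exponent le_top
  have hrep : ∀ n, l.comp (mulCLM p (hone n)) = pairCLM p (hgq n) := by
    intro n
    refine functional_ext hp.ne fun s hs => ?_
    have e : mulCLM p (hone n) (indicatorConstLp p hs (measure_ne_top μ s) 1) =
        indicatorConstLp p (hs.inter (hAm n)) (measure_ne_top μ _) 1 := by
      refine Lp.ext ?_
      filter_upwards [coeFn_mulCLM (hone n) (indicatorConstLp p hs (measure_ne_top μ s) 1),
        indicatorConstLp_coeFn (p := p) (hs := hs) (hμs := measure_ne_top μ s) (c := (1 : ℂ)),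
        indicatorConstLp_coeFn (p := p) (hs := hs.inter (hAm n)) (hμs := measure_ne_top μ _)
          (c := (1 : ℂ))] with x h1 h2 h3
      rw [h1, h2, h3]
      by_cases hx : x ∈ s <;> by_cases hx' : x ∈ A n <;> simp [hx, hx']
    rw [ContinuousLinearMap.comp_apply, e, hl, pairCLM_apply, ← integral_indicator
      (hs.inter (hAm n))]
    refine integral_congr_ae ?_
    filter_upwards [indicatorConstLp_coeFn (p := p) (hs := hs) (hμs := measure_ne_top μ s)
      (c := (1 : ℂ))] with x h2
    rw [h2]
    by_cases hx : x ∈ s <;> by_cases hx' : x ∈ A n <;> simp [hx, hx']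
  have hbound : ∀ n, eLpNorm ((A n).indicator g) q μ ≤ ENNReal.ofReal ‖l‖ := by
    intro n
    refine eLpNorm_le_of_pairing_le hp1 hp (hgq n) fun f => ?_
    rw [← pairCLM_apply (hgq n) f, ← hrep n, ContinuousLinearMap.comp_apply]
    refine (l.le_opNorm _).trans (mul_le_mul_of_nonneg_left ?_ (norm_nonneg _))
    refine Lp.norm_le_norm_of_ae_le ?_
    filter_upwards [coeFn_mulCLM (hone n) f] with x hx
    rw [hx]
    by_cases hx' : x ∈ A n <;> simp [hx']
  have hlim : ∀ᵐ x ∂μ, Tendsto (fun n => (A n).indicator g x) atTop (𝓝 (g x)) :=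
    Eventually.of_forall fun x => by
      refine tendsto_const_nhds.congr' ?_
      filter_upwards [eventually_ge_atTop ⌈‖g x‖⌉₊] with n hn
      have : x ∈ A n := (Nat.le_ceil ‖g x‖).trans (by exact_mod_cast hn)
      simp [this]
  have hgL : MemLp g q μ := by
    refine ⟨hgm.aestronglyMeasurable, ?_⟩
    refine (Lp.eLpNorm_lim_le_liminf_eLpNorm (fun n => (hgq n).1) g hlim).trans_lt ?_
    refine lt_of_le_of_lt ?_ (ENNReal.ofReal_lt_top (r := ‖l‖))
    refine (Filter.liminf_le_liminf (Eventually.of_forall hbound)).trans ?_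
    simp
  refine ⟨g, hgL, fun f => ?_⟩
  rw [← pairCLM_apply hgL f]
  congr 1
  refine functional_ext hp.ne fun s hs => ?_
  rw [hl, pairCLM_apply, ← integral_indicator hs]
  refine integral_congr_ae ?_
  filter_upwards [indicatorConstLp_coeFn (p := p) (hs := hs) (hμs := measure_ne_top μ s)
    (c := (1 : ℂ))] with x h2
  rw [h2]
  by_cases hx : x ∈ s <;> simp [hx]

end Duality

/-! ### Fourier coefficients and trigonometric polynomials -/

section Fourier

theorem norm_tpow (n : ℤ) (x : Circ) : ‖tpow n x‖ = 1 := by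
  rw [tpow, fourier_apply, Circle.norm_coe]

theorem tpow_ne_zero (n : ℤ) (x : Circ) : tpow n x ≠ 0 := by
  rw [← norm_ne_zero_iff, norm_tpow]
  exact one_ne_zero

theorem tpow_add (m n : ℤ) (x : Circ) : tpow (m + n) x = tpow m x * tpow n x := fourier_add

theorem tpow_zero (x : Circ) : tpow 0 x = 1 := fourier_zero

theorem tpow_neg_arg (n : ℤ) (x : Circ) : tpow n (-x) = tpow (-n) x := by
  simp only [tpow, fourier_apply, smul_neg, neg_smul]

theorem tpow_mul_neg (n : ℤ) (x : Circ) : tpow n x * tpow (-n) x = 1 := by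
  rw [← tpow_add, add_neg_cancel, tpow_zero]

theorem conj_tpow (n : ℤ) (x : Circ) : (starRingEnd ℂ) (tpow n x) = tpow (-n) x :=
  fourier_neg.symm

theorem continuous_tpow (n : ℤ) : Continuous (tpow n) := (fourier n).continuous

theorem tpow_eq_pow (n : ℕ) (x : Circ) : tpow n x = tpow 1 x ^ n := by
  induction n with
  | zero => rw [Nat.cast_zero, tpow_zero, pow_zero]
  | succ k ih => rw [Nat.cast_succ, tpow_add, ih, pow_succ]

theorem memLp_of_continuous {f : Circ → ℂ} (hf : Continuous f) (p : ℝ≥0∞) :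
    MemLp f p circMeasure :=
  MemLp.of_bound hf.aestronglyMeasurable ‖(⟨f, hf⟩ : C(Circ, ℂ))‖
    (Eventually.of_forall (⟨f, hf⟩ : C(Circ, ℂ)).norm_coe_le_norm)

theorem integrable_tpow_mul {f : Circ → ℂ} (hf : Integrable f circMeasure) (m : ℤ) :
    Integrable (fun x => tpow m x * f x) circMeasure := hf.fourier_smul m

theorem memLp_tpow_mul {p : ℝ≥0∞} {f : Circ → ℂ} (hf : MemLp f p circMeasure) (m : ℤ) :
    MemLp (fun x => tpow m x * f x) p circMeasure := by
  refine hf.of_le ((continuous_tpow m).aestronglyMeasurable.mul hf.1)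
    (Eventually.of_forall fun x => ?_)
  rw [norm_mul, norm_tpow, one_mul]

theorem memLp_neg_arg {p : ℝ≥0∞} {f : Circ → ℂ} (hf : MemLp f p circMeasure) :
    MemLp (fun x => f (-x)) p circMeasure :=
  hf.comp_measurePreserving (Measure.measurePreserving_neg circMeasure)

theorem memLp_conj {p : ℝ≥0∞} {f : Circ → ℂ} (hf : MemLp f p circMeasure) :
    MemLp (fun x => (starRingEnd ℂ) (f x)) p circMeasure :=
  hf.of_le (continuous_conj.comp_aestronglyMeasurable hf.1)
    (Eventually.of_forall fun x => by rw [RCLike.norm_conj])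

theorem memLp_flip {p : ℝ≥0∞} {f : Circ → ℂ} (hf : MemLp f p circMeasure) :
    MemLp (flip f) p circMeasure := memLp_tpow_mul (memLp_neg_arg hf) (-1)

theorem integrable_neg_arg {f : Circ → ℂ} (hf : Integrable f circMeasure) :
    Integrable (fun x => f (-x)) circMeasure :=
  memLp_one_iff_integrable.1 (memLp_neg_arg (memLp_one_iff_integrable.2 hf))

theorem integrable_flip {f : Circ → ℂ} (hf : Integrable f circMeasure) :
    Integrable (flip f) circMeasure := integrable_tpow_mul (integrable_neg_arg hf) (-1)

theorem fourierCoeff_def (f : Circ → ℂ) (n : ℤ) :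
    fourierCoeff f n = ∫ x, tpow (-n) x * f x ∂circMeasure := rfl

theorem fourierCoeff_tpow_mul (m : ℤ) (f : Circ → ℂ) (n : ℤ) :
    fourierCoeff (fun x => tpow m x * f x) n = fourierCoeff f (n - m) := by
  rw [fourierCoeff_def, fourierCoeff_def]
  congr 1
  funext x
  rw [← mul_assoc, ← tpow_add]
  congr 2
  ring

theorem fourierCoeff_neg_arg (f : Circ → ℂ) (n : ℤ) :
    fourierCoeff (fun x => f (-x)) n = fourierCoeff f (-n) := by
  rw [fourierCoeff_def, fourierCoeff_def, ← integral_neg_eq_self]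
  simp only [neg_neg, tpow_neg_arg]

theorem fourierCoeff_conj (f : Circ → ℂ) (n : ℤ) :
    fourierCoeff (fun x => (starRingEnd ℂ) (f x)) n = (starRingEnd ℂ) (fourierCoeff f (-n)) := by
  rw [fourierCoeff_def, fourierCoeff_def, ← integral_conj]
  simp only [map_mul, conj_tpow, neg_neg]

theorem fourierCoeff_flip (f : Circ → ℂ) (n : ℤ) :
    fourierCoeff (flip f) n = fourierCoeff f (-n - 1) := by
  have := fourierCoeff_tpow_mul (-1) (fun x => f (-x)) n
  rw [fourierCoeff_neg_arg] at this
  refine this.trans ?_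
  congr 1
  ring

theorem fourierCoeff_add' {f g : Circ → ℂ} (hf : Integrable f circMeasure)
    (hg : Integrable g circMeasure) (n : ℤ) :
    fourierCoeff (fun x => f x + g x) n = fourierCoeff f n + fourierCoeff g n :=
  congrFun (fourierCoeff.add hf hg) n

theorem fourierCoeff_neg' (f : Circ → ℂ) (n : ℤ) :
    fourierCoeff (fun x => -f x) n = -fourierCoeff f n := by
  have := fourierCoeff.const_mul f (-1) n
  simpa using this

theorem fourierCoeff_sub' {f g : Circ → ℂ} (hf : Integrable f circMeasure)
    (hg : Integrable g circMeasure) (n : ℤ) :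
    fourierCoeff (fun x => f x - g x) n = fourierCoeff f n - fourierCoeff g n := by
  simp only [sub_eq_add_neg]
  rw [fourierCoeff_add' hf hg.fun_neg, fourierCoeff_neg']

theorem fourierCoeff_tpow (m n : ℤ) : fourierCoeff (tpow m) n = if n = m then 1 else 0 := by
  have := congrFun (fourierCoeff_fourier (T := 1) m) n
  rw [Pi.single_apply] at this
  exact this

theorem norm_fourierCoeff_le {f : Circ → ℂ} (n : ℤ) :
    ‖fourierCoeff f n‖ ≤ ∫ x, ‖f x‖ ∂circMeasure := by
  rw [fourierCoeff_def]
  refine (norm_integral_le_integral_norm _).trans_eq ?_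
  simp only [norm_mul, norm_tpow, one_mul]

theorem integral_norm_le_norm {p : ℝ≥0∞} [hp : Fact (1 ≤ p)] (f : Lp ℂ p circMeasure) :
    ∫ x, ‖f x‖ ∂circMeasure ≤ ‖f‖ := by
  rw [Lp.norm_def, integral_norm_eq_lintegral_enorm (Lp.aestronglyMeasurable f),
    ← eLpNorm_one_eq_lintegral_enorm]
  exact ENNReal.toReal_mono (Lp.eLpNorm_ne_top f)
    (eLpNorm_le_eLpNorm_of_exponent_le hp.out (Lp.aestronglyMeasurable f))

/-- The `n`-th Fourier coefficient as a bounded functional on `L^p`. -/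
noncomputable def coeffCLM (p : ℝ≥0∞) [Fact (1 ≤ p)] (n : ℤ) : Lp ℂ p circMeasure →L[ℂ] ℂ :=
  LinearMap.mkContinuous
    { toFun := fun f => fourierCoeff f n
      map_add' := fun f g => by
        rw [fourierCoeff_congr (Lp.coeFn_add f g) n,
          fourierCoeff.add (integrable_coe p f) (integrable_coe p g), Pi.add_apply]
      map_smul' := fun c f => by
        rw [fourierCoeff_congr (Lp.coeFn_smul c f) n, fourierCoeff.const_smul]
        rfl } 1
    fun f => by
      rw [one_mul]
      exact (norm_fourierCoeff_le n).trans (integral_norm_le_norm f)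

theorem coeffCLM_apply (p : ℝ≥0∞) [Fact (1 ≤ p)] (n : ℤ) (f : Lp ℂ p circMeasure) :
    coeffCLM p n f = fourierCoeff f n := rfl

/-- An integrable function is determined by its Fourier coefficients. -/
theorem ae_eq_zero_of_fourierCoeff {f : Circ → ℂ} (hf : Integrable f circMeasure)
    (h : ∀ n, fourierCoeff f n = 0) : f =ᵐ[circMeasure] 0 := by
  have hi : ∀ g : C(Circ, ℂ), Integrable (fun x => g x * f x) circMeasure := fun g =>
    hf.bdd_mul (c := ‖g‖) g.continuous.aestronglyMeasurable
      (Eventually.of_forall g.norm_coe_le_norm)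
  have hC : ∀ g : C(Circ, ℂ), ∫ x, g x * f x ∂circMeasure = 0 := by
    let l : C(Circ, ℂ) →L[ℂ] ℂ := LinearMap.mkContinuous
      { toFun := fun g => ∫ x, g x * f x ∂circMeasure
        map_add' := fun g k => by
          rw [← integral_add (hi g) (hi k)]
          simp only [ContinuousMap.add_apply, add_mul]
        map_smul' := fun c g => by
          simp only [ContinuousMap.smul_apply, smul_eq_mul, mul_assoc, integral_const_mul,
            RingHom.id_apply] } (∫ x, ‖f x‖ ∂circMeasure)
      fun g => by
        refine (norm_integral_le_integral_norm _).trans ?_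
        rw [mul_comm, ← integral_const_mul]
        refine integral_mono (hi g).norm (hf.norm.const_mul _) fun x => ?_
        simp only [norm_mul]
        exact mul_le_mul_of_nonneg_right (g.norm_coe_le_norm x) (norm_nonneg _)
    have hl : l = 0 := by
      refine ContinuousLinearMap.ext_on (s := Set.range (fun n : ℤ => (fourier n : C(Circ, ℂ))))
        ?_ ?_
      · rw [Submodule.dense_iff_topologicalClosure_eq_top]
        exact span_fourier_closure_eq_top
      · rintro _ ⟨n, rfl⟩
        have := h (-n)
        rw [fourierCoeff_def, neg_neg] at this
        exact this
    intro g
    exact congrArg (fun m : C(Circ, ℂ) →L[ℂ] ℂ => m g) hl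
  -- Continuous functions approximate the indicator of a closed set.
  refine ae_eq_zero_of_forall_setIntegral_isClosed_eq_zero hf fun s hs => ?_
  have hδ : ∀ n : ℕ, (0 : ℝ) < 1 / (n + 1) := fun n => by positivity
  let g : ℕ → C(Circ, ℂ) := fun n =>
    ⟨fun x => ((thickenedIndicator (hδ n) s x : ℝ) : ℂ), by fun_prop⟩
  have hlim : Tendsto (fun n => ∫ x, g n x * f x ∂circMeasure) atTop
      (𝓝 (∫ x, s.indicator f x ∂circMeasure)) := by
    refine tendsto_integral_of_dominated_convergence (fun x => ‖f x‖)
      (fun n => (hi (g n)).aestronglyMeasurable) hf.norm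
      (fun n => Eventually.of_forall fun x => ?_) (Eventually.of_forall fun x => ?_)
    · rw [norm_mul]
      refine mul_le_of_le_one_left (norm_nonneg _) ?_
      have : thickenedIndicator (hδ n) s x ≤ 1 := thickenedIndicator_le_one _ _ _
      change ‖((thickenedIndicator (hδ n) s x : ℝ) : ℂ)‖ ≤ 1
      rw [norm_real, NNReal.norm_eq]
      exact_mod_cast this
    · have := thickenedIndicator_tendsto_indicator_closure hδ
        tendsto_one_div_add_atTop_nhds_zero_nat s
      rw [hs.closure_eq, tendsto_pi_nhds] at this
      have h1 := ((continuous_ofReal.comp NNReal.continuous_coe).tendsto _).comp (this x)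
      have h2 := h1.mul_const (f x)
      convert h2 using 2
      · rfl
      · by_cases hx : x ∈ s <;> simp [hx]
  simp only [hC] at hlim
  rw [← integral_indicator hs.measurableSet]
  exact (tendsto_nhds_unique hlim tendsto_const_nhds)

theorem ae_eq_of_fourierCoeff {f g : Circ → ℂ} (hf : Integrable f circMeasure)
    (hg : Integrable g circMeasure) (h : ∀ n, fourierCoeff f n = fourierCoeff g n) :
    f =ᵐ[circMeasure] g := by
  have := ae_eq_zero_of_fourierCoeff (hf.sub hg) fun n => by
    have := fourierCoeff_sub' hf hg n
    rw [h n, sub_self] at this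
    exact this
  filter_upwards [this] with x hx
  exact sub_eq_zero.1 hx

/-- The trigonometric polynomial with given coefficients. -/
noncomputable def trig : (ℤ →₀ ℂ) →ₗ[ℂ] C(Circ, ℂ) :=
  Finsupp.linearCombination ℂ (fun n : ℤ => (fourier n : C(Circ, ℂ)))

theorem range_trig : LinearMap.range trig = trigPoly := Finsupp.range_linearCombination _

theorem trig_single (n : ℤ) (a : ℂ) (x : Circ) : trig (Finsupp.single n a) x = a * tpow n x := by
  simp [trig, Finsupp.linearCombination_single, -fourier_apply]

theorem trig_apply (c : ℤ →₀ ℂ) (x : Circ) : trig c x = c.sum fun n a => a * tpow n x := by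
  rw [trig, Finsupp.linearCombination_apply, Finsupp.sum, Finsupp.sum, ContinuousMap.coe_sum,
    Finset.sum_apply]
  rfl

theorem integrable_continuousMap (f : C(Circ, ℂ)) : Integrable f circMeasure :=
  memLp_one_iff_integrable.1 (f.memLp circMeasure ℂ)

theorem fourierCoeff_trig (c : ℤ →₀ ℂ) (n : ℤ) : fourierCoeff (trig c) n = c n := by
  induction c using Finsupp.induction_linear with
  | zero => simp [fourierCoeff]
  | add f g hf hg =>
    rw [map_add, Finsupp.add_apply, ← hf, ← hg]
    exact fourierCoeff_add' (integrable_continuousMap _) (integrable_continuousMap _) n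
  | single m a =>
    have : (trig (Finsupp.single m a) : Circ → ℂ) = fun x => a * tpow m x := by
      funext x; exact trig_single m a x
    rw [this, fourierCoeff.const_mul, fourierCoeff_tpow, Finsupp.single_apply]
    by_cases h : n = m
    · simp [h]
    · simp [h, Ne.symm h]

theorem denseRange_trig : DenseRange trig := by
  have := span_fourier_closure_eq_top (T := 1)
  rw [← Submodule.dense_iff_topologicalClosure_eq_top] at this
  have h2 : ((LinearMap.range trig : Submodule ℂ C(Circ, ℂ)) : Set C(Circ, ℂ)) = Set.range trig :=
    LinearMap.coe_range _
  rw [DenseRange, ← h2, range_trig]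
  exact this

/-- Trigonometric polynomials as elements of `L^p`. -/
noncomputable def trigLp (p : ℝ≥0∞) [Fact (1 ≤ p)] : (ℤ →₀ ℂ) →ₗ[ℂ] Lp ℂ p circMeasure :=
  (ContinuousMap.toLp (E := ℂ) p circMeasure ℂ).toLinearMap.comp trig

theorem coeFn_trigLp (p : ℝ≥0∞) [Fact (1 ≤ p)] (c : ℤ →₀ ℂ) :
    trigLp p c =ᵐ[circMeasure] trig c := ContinuousMap.coeFn_toLp circMeasure (trig c)

theorem denseRange_trigLp {p : ℝ≥0∞} [Fact (1 ≤ p)] (hp : p ≠ ∞) : DenseRange (trigLp p) :=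
  (ContinuousMap.toLp_denseRange ℂ circMeasure ℂ hp).comp denseRange_trig
    (ContinuousMap.toLp (E := ℂ) p circMeasure ℂ).continuous

/-- The Riemann–Lebesgue lemma. -/
theorem tendsto_fourierCoeff_atTop {f : Circ → ℂ} (hf : Integrable f circMeasure) :
    Tendsto (fun n : ℕ => fourierCoeff f n) atTop (𝓝 0) := by
  have h1 : Fact ((1 : ℝ≥0∞) ≤ 1) := ⟨le_rfl⟩
  rw [Metric.tendsto_atTop]
  intro ε hε
  let F : Lp ℂ 1 circMeasure := (memLp_one_iff_integrable.2 hf).toLp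
  have hF : F =ᵐ[circMeasure] f := (memLp_one_iff_integrable.2 hf).coeFn_toLp
  obtain ⟨c, hc⟩ := (denseRange_trigLp (p := 1) ENNReal.one_ne_top).exists_dist_lt F hε
  obtain ⟨N, hN⟩ := c.support.exists_le
  refine ⟨N.toNat + 1, fun n hn => ?_⟩
  have hcn : c n = 0 := by
    by_contra h
    have := hN n (Finsupp.mem_support_iff.2 h)
    omega
  have h2 : fourierCoeff (trigLp 1 c : Circ → ℂ) n = 0 := by
    rw [fourierCoeff_congr (coeFn_trigLp 1 c), fourierCoeff_trig, hcn]
  rw [dist_zero_right, ← fourierCoeff_congr hF, ← sub_zero (fourierCoeff F n), ← h2,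
    ← coeffCLM_apply, ← coeffCLM_apply, ← map_sub, coeffCLM_apply]
  refine ((norm_fourierCoeff_le _).trans (integral_norm_le_norm _)).trans_lt ?_
  rwa [← dist_eq_norm]

end Fourier

/-! ### Positive trigonometric polynomials and analytic functions with positive real part -/

section PositivePolynomials

/-- An elementary inequality on the right half plane: for `1 < p ≤ 2`, the harmonic function
`Re z ^ p` is negative near the imaginary axis, and so controls `|z| ^ p` where `(Re z) ^ p`
does not. -/
theorem exists_norm_rpow_le {p : ℝ} (hp1 : 1 < p) (hp2 : p ≤ 2) :
    ∃ A B : ℝ, 0 ≤ A ∧ 0 ≤ B ∧ ∀ z : ℂ, 0 < z.re →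
      ‖z‖ ^ p ≤ A * z.re ^ p - B * (z ^ (p : ℂ)).re := by
  have hpi := Real.pi_pos
  set θ₀ : ℝ := (Real.pi / 2 + p * (Real.pi / 2)) / (2 * p) with hθ₀
  have hpθ : p * θ₀ = (Real.pi / 2 + p * (Real.pi / 2)) / 2 := by
    rw [hθ₀]; field_simp
  have h1 : Real.pi / 2 < p * θ₀ := by rw [hpθ]; nlinarith
  have h2 : p * θ₀ ≤ Real.pi := by rw [hpθ]; nlinarith
  have h3 : θ₀ < Real.pi / 2 := by
    refine lt_of_mul_lt_mul_left (a := p) ?_ (by linarith)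
    rw [hpθ]; nlinarith
  have h4 : 0 < θ₀ := by
    rw [hθ₀]; positivity
  have hc0 : 0 < Real.cos θ₀ := Real.cos_pos_of_mem_Ioo ⟨by linarith, h3⟩
  have hc1 : Real.cos (p * θ₀) < 0 := Real.cos_neg_of_pi_div_two_lt_of_lt h1 (by linarith)
  set B : ℝ := (-Real.cos (p * θ₀))⁻¹ with hB
  have hB0 : 0 < B := inv_pos.2 (by linarith)
  have hBc : B * Real.cos (p * θ₀) = -1 := by
    rw [hB, inv_neg, neg_mul, inv_mul_cancel₀ hc1.ne]
  set A : ℝ := (1 + B) / Real.cos θ₀ ^ p with hA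
  have hcp : 0 < Real.cos θ₀ ^ p := Real.rpow_pos_of_pos hc0 p
  have hA0 : 0 < A := by positivity
  refine ⟨A, B, hA0.le, hB0.le, fun z hz => ?_⟩
  have hθ : |arg z| < Real.pi / 2 := abs_arg_lt_pi_div_two_iff.2 (Or.inl hz)
  have hre : z.re = ‖z‖ * Real.cos |arg z| := by rw [Real.cos_abs, norm_mul_cos_arg]
  have hcos0 : 0 ≤ Real.cos |arg z| :=
    Real.cos_nonneg_of_mem_Icc ⟨by linarith [abs_nonneg (arg z)], hθ.le⟩
  have hcosp : Real.cos (arg z * p) = Real.cos (p * |arg z|) := by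
    rw [← Real.cos_abs, abs_mul, abs_of_pos (by linarith : 0 < p), mul_comm]
  have key : 1 ≤ A * Real.cos |arg z| ^ p - B * Real.cos (p * |arg z|) := by
    rcases le_total |arg z| θ₀ with h | h
    · have e1 : Real.cos θ₀ ≤ Real.cos |arg z| :=
        Real.cos_le_cos_of_nonneg_of_le_pi (abs_nonneg _) (by linarith) h
      have e2 : Real.cos θ₀ ^ p ≤ Real.cos |arg z| ^ p :=
        Real.rpow_le_rpow hc0.le e1 (by linarith)
      have e3 : A * Real.cos θ₀ ^ p = 1 + B := by rw [hA]; field_simp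
      have e4 := mul_le_mul_of_nonneg_left e2 hA0.le
      have e5 := mul_le_mul_of_nonneg_left (Real.cos_le_one (p * |arg z|)) hB0.le
      linarith
    · have e1 : Real.cos (p * |arg z|) ≤ Real.cos (p * θ₀) := by
        refine Real.cos_le_cos_of_nonneg_of_le_pi (by positivity) ?_
          (mul_le_mul_of_nonneg_left h (by linarith))
        nlinarith [abs_nonneg (arg z)]
      have e2 := mul_le_mul_of_nonneg_left e1 hB0.le
      have e3 : 0 ≤ A * Real.cos |arg z| ^ p := by positivity
      linarith
  have hnn : 0 ≤ ‖z‖ ^ p := by positivity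
  calc ‖z‖ ^ p ≤ ‖z‖ ^ p * (A * Real.cos |arg z| ^ p - B * Real.cos (p * |arg z|)) :=
        le_mul_of_one_le_right hnn key
    _ = A * z.re ^ p - B * (z ^ (p : ℂ)).re := by
        rw [cpow_ofReal_re, hcosp, hre, Real.mul_rpow (norm_nonneg _) hcos0]
        ring

/-- The mean value property on the unit circle. -/
theorem integral_tpow_one_comp {F : ℂ → ℂ} (hF : DiffContOnCl ℂ F (Metric.ball 0 1)) :
    ∫ x, F (tpow 1 x) ∂circMeasure = F 0 := by
  have h1 : fourierCoeff (fun x : Circ => F (tpow 1 x)) 0 = F 0 := by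
    rw [fourierCoeff_eq_intervalIntegral _ _ 0]
    have h2 := DiffContOnCl.circleAverage (f := F) (c := 0) (R := 1) (by simpa using hF)
    rw [Real.circleAverage_def] at h2
    rw [← h2]
    have h3 := intervalIntegral.integral_comp_mul_left (a := 0) (b := 1)
      (fun θ => F (circleMap 0 1 θ)) (c := 2 * Real.pi) (by positivity)
    rw [mul_zero, mul_one] at h3
    rw [← h3]
    simp only [neg_zero, fourier_zero, one_smul, zero_add, one_div, inv_one]
    refine intervalIntegral.integral_congr fun x _ => ?_
    simp only [tpow, fourier_coe_apply, circleMap]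
    congr 1
    push_cast
    simp only [one_mul, zero_add]
    congr 1
    ring
  rw [← h1, fourierCoeff_def]
  simp only [neg_zero, tpow_zero, one_mul]

/-- The part of a coefficient family with indices `n ≥ 0`. -/
noncomputable def analyticPart (c : ℤ →₀ ℂ) : ℤ →₀ ℂ := c.filter (0 ≤ ·)

theorem analyticPart_apply (c : ℤ →₀ ℂ) (n : ℤ) :
    analyticPart c n = if 0 ≤ n then c n else 0 := by
  rw [analyticPart, Finsupp.filter_apply]

theorem analyticPart_add (c d : ℤ →₀ ℂ) :
    analyticPart (c + d) = analyticPart c + analyticPart d := Finsupp.filter_add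

theorem analyticPart_smul (a : ℂ) (c : ℤ →₀ ℂ) :
    analyticPart (a • c) = a • analyticPart c := Finsupp.filter_smul

/-- The analytic polynomial `∑_{n ≥ 0} c_n z ^ n`. -/
noncomputable def analyticPoly (c : ℤ →₀ ℂ) (z : ℂ) : ℂ :=
  (analyticPart c).sum fun n a => a * z ^ n.toNat

theorem differentiable_analyticPoly (c : ℤ →₀ ℂ) : Differentiable ℂ (analyticPoly c) := by
  unfold analyticPoly Finsupp.sum
  fun_prop

theorem analyticPoly_tpow (c : ℤ →₀ ℂ) (x : Circ) :
    analyticPoly c (tpow 1 x) = trig (analyticPart c) x := by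
  rw [trig_apply, analyticPoly]
  refine Finsupp.sum_congr fun n hn => ?_
  have h0 : 0 ≤ n := by
    by_contra h
    rw [Finsupp.mem_support_iff, analyticPart_apply, if_neg h] at hn
    exact hn rfl
  rw [← tpow_eq_pow, Int.toNat_of_nonneg h0]

theorem analyticPoly_zero (c : ℤ →₀ ℂ) : analyticPoly c 0 = c 0 := by
  rw [analyticPoly, Finsupp.sum]
  by_cases h : c 0 = 0
  · rw [h]
    refine Finset.sum_eq_zero fun n hn => ?_
    rw [Finsupp.mem_support_iff, analyticPart_apply] at hn
    have h1 : n.toNat ≠ 0 := by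
      intro h2
      by_cases h3 : 0 ≤ n
      · have : n = 0 := by omega
        rw [this] at hn
        simp [h] at hn
      · simp [h3] at hn
    rw [zero_pow h1, mul_zero]
  · rw [Finset.sum_eq_single 0]
    · simp [analyticPart_apply]
    · intro n hn h0
      rw [Finsupp.mem_support_iff, analyticPart_apply] at hn
      have h1 : n.toNat ≠ 0 := by
        intro h2
        by_cases h3 : 0 ≤ n
        · omega
        · simp [h3] at hn
      rw [zero_pow h1, mul_zero]
    · intro hn
      rw [Finsupp.notMem_support_iff, analyticPart_apply] at hn
      simp only [le_refl, if_true] at hn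
      exact absurd hn h

/-- A real trigonometric polynomial is the real part of twice its analytic part, up to the constant
term. -/
theorem re_two_mul_analyticPart (c : ℤ →₀ ℂ) (hr : ∀ x, (trig c x).im = 0) (x : Circ) :
    (2 * trig (analyticPart c) x - c 0).re = (trig c x).re := by
  have hconj : ∀ n, (starRingEnd ℂ) (c (-n)) = c n := by
    intro n
    rw [← fourierCoeff_trig c (-n), ← fourierCoeff_conj, ← fourierCoeff_trig c n]
    congr 1
    funext y
    exact conj_eq_iff_im.2 (hr y)
  set a : Circ → ℂ := fun y => trig (analyticPart c) y with ha
  have hac : Continuous a := (trig (analyticPart c)).continuous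
  have hai : Integrable a circMeasure := integrable_continuousMap _
  have haic : Integrable (fun y => (starRingEnd ℂ) (a y)) circMeasure :=
    memLp_one_iff_integrable.1 (memLp_conj (memLp_one_iff_integrable.2 hai))
  have hk : Integrable (fun y => c 0 * tpow 0 y) circMeasure :=
    memLp_one_iff_integrable.1 (memLp_of_continuous (by fun_prop) 1)
  have hae : (fun y => a y + (starRingEnd ℂ) (a y)) =ᵐ[circMeasure]
      fun y => trig c y + c 0 * tpow 0 y := by
    refine ae_eq_of_fourierCoeff (hai.add haic) ((integrable_continuousMap _).add hk) fun n => ?_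
    rw [fourierCoeff_add' hai haic, fourierCoeff_add' (integrable_continuousMap _) hk,
      fourierCoeff_conj, fourierCoeff.const_mul, fourierCoeff_tpow, ha, fourierCoeff_trig,
      fourierCoeff_trig, fourierCoeff_trig, analyticPart_apply, analyticPart_apply]
    rcases lt_trichotomy n 0 with h | h | h
    · rw [if_neg (by omega), if_pos (by omega), if_neg (by omega), hconj]
      ring
    · subst h
      have := hconj 0
      rw [neg_zero] at this
      simp [this]
    · rw [if_pos (by omega), if_neg (by omega), if_neg (by omega)]
      simp
  have hev := congrFun ((Continuous.ae_eq_iff_eq circMeasure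
    (by fun_prop) (by fun_prop)).1 hae) x
  have h0 := congrArg Complex.re hev
  simp only [tpow_zero, add_re, conj_re, mul_one] at h0
  simp only [sub_re, mul_re, re_ofNat, im_ofNat, zero_mul, sub_zero]
  change 2 * (a x).re - _ = _
  linarith

/-- The core of the theorem of M. Riesz: for a positive trigonometric polynomial `u` and
`1 < p ≤ 2`, the analytic function `F` with `Re F = u` maps the disc to the right half plane, and
the mean value property of `F ^ p` bounds the norm of `F` by that of `u`. -/
theorem integral_analyticPart_le {p A B : ℝ} (hp1 : 1 < p) (hB : 0 ≤ B)
    (hAB : ∀ z : ℂ, 0 < z.re → ‖z‖ ^ p ≤ A * z.re ^ p - B * (z ^ (p : ℂ)).re)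
    (c : ℤ →₀ ℂ) (hr : ∀ x, (trig c x).im = 0) {ε : ℝ} (hε : 0 < ε)
    (hpos : ∀ x, ε ≤ (trig c x).re) :
    ∫ x, ‖2 * trig (analyticPart c) x - c 0‖ ^ p ∂circMeasure ≤
      A * ∫ x, (trig c x).re ^ p ∂circMeasure := by
  set G : ℂ → ℂ := fun z => 2 * analyticPoly c z - c 0 with hG
  have hGd : Differentiable ℂ G :=
    ((differentiable_analyticPoly c).const_mul 2).sub_const _
  have hGt : ∀ x, G (tpow 1 x) = 2 * trig (analyticPart c) x - c 0 := fun x => by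
    simp only [hG, analyticPoly_tpow]
  have hGre : ∀ x, (G (tpow 1 x)).re = (trig c x).re := fun x => by
    rw [hGt, re_two_mul_analyticPart c hr]
  have hsurj : ∀ z : ℂ, ‖z‖ = 1 → ∃ x : Circ, tpow 1 x = z := by
    intro z hz
    obtain ⟨x, hx⟩ := (AddCircle.homeomorphCircle (one_ne_zero (α := ℝ))).surjective
      (⟨z, mem_sphere_zero_iff_norm.2 hz⟩ : Circle)
    refine ⟨x, ?_⟩
    rw [AddCircle.homeomorphCircle_apply] at hx
    rw [tpow, fourier_one, hx]
  have hGball : ∀ z ∈ closure (Metric.ball (0 : ℂ) 1), ε ≤ (G z).re := by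
    intro z hz
    have := norm_le_of_forall_mem_frontier_norm_le (f := fun z => exp (-G z))
      (U := Metric.ball (0 : ℂ) 1) (C := Real.exp (-ε)) Metric.isBounded_ball
      (hGd.neg.cexp.diffContOnCl) (fun w hw => by
        rw [frontier_ball _ one_ne_zero, mem_sphere_zero_iff_norm] at hw
        obtain ⟨x, rfl⟩ := hsurj w hw
        rw [norm_exp, neg_re, hGre]
        exact Real.exp_le_exp.2 (neg_le_neg (hpos x))) hz
    rw [norm_exp, Real.exp_le_exp, neg_re] at this
    linarith
  have hmv := integral_tpow_one_comp (F := fun z => G z ^ (p : ℂ)) (by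
    refine DifferentiableOn.diffContOnCl fun z hz => ?_
    have : 0 < (G z).re := hε.trans_le (hGball z hz)
    exact ((hGd z).cpow_const (Or.inl this)).differentiableWithinAt)
  have hG0 : G 0 = c 0 := by
    simp only [hG, analyticPoly_zero]; ring
  have hc0 : 0 < (c 0).re := by
    rw [← hG0]
    exact hε.trans_le (hGball 0 (subset_closure (by simp)))
  have hc0im : (c 0).im = 0 := by
    have h := fourierCoeff_conj (trig c) 0
    have e : (fun x => (starRingEnd ℂ) (trig c x)) = trig c := by
      funext y; exact conj_eq_iff_im.2 (hr y)
    rw [e, neg_zero, fourierCoeff_trig] at h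
    exact conj_eq_iff_im.1 h.symm
  have hmv0 : 0 ≤ (∫ x, G (tpow 1 x) ^ (p : ℂ) ∂circMeasure).re := by
    rw [hmv, hG0]
    have : c 0 = ((c 0).re : ℂ) := Complex.ext rfl (by simpa using hc0im)
    rw [this, ← ofReal_cpow hc0.le, ofReal_re]
    positivity
  have hGc : Continuous fun x : Circ => G (tpow 1 x) := hGd.continuous.comp (continuous_tpow 1)
  have hGpc : Continuous fun x : Circ => G (tpow 1 x) ^ (p : ℂ) := by
    refine hGc.cpow continuous_const fun x => Or.inl ?_
    rw [hGre]
    exact hε.trans_le (hpos x)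
  have hint : ∀ {f : Circ → ℝ}, Continuous f → Integrable f circMeasure := fun hf =>
    hf.integrable_of_hasCompactSupport (HasCompactSupport.of_compactSpace _)
  have i1 : Integrable (fun x => ‖2 * trig (analyticPart c) x - c 0‖ ^ p) circMeasure :=
    hint (Continuous.rpow_const (by fun_prop) fun _ => Or.inr (by linarith))
  have i2 : Integrable (fun x => (trig c x).re ^ p) circMeasure :=
    hint (Continuous.rpow_const (by fun_prop) fun _ => Or.inr (by linarith))
  have i3 : Integrable (fun x => (G (tpow 1 x) ^ (p : ℂ)).re) circMeasure :=
    hint (continuous_re.comp hGpc)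
  calc ∫ x, ‖2 * trig (analyticPart c) x - c 0‖ ^ p ∂circMeasure
      ≤ ∫ x, (A * (trig c x).re ^ p - B * (G (tpow 1 x) ^ (p : ℂ)).re) ∂circMeasure := by
        refine integral_mono i1 ((i2.const_mul A).sub (i3.const_mul B)) fun x => ?_
        have := hAB (G (tpow 1 x)) (by rw [hGre]; exact hε.trans_le (hpos x))
        rw [hGre, hGt] at this
        rw [← hGt] at this ⊢
        exact this
    _ = A * ∫ x, (trig c x).re ^ p ∂circMeasure
          - B * (∫ x, G (tpow 1 x) ^ (p : ℂ) ∂circMeasure).re := by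
        rw [integral_sub (i2.const_mul A) (i3.const_mul B), integral_const_mul, integral_const_mul]
        congr 2
        exact integral_re (𝕜 := ℂ) (hGpc.integrable_of_hasCompactSupport
          (HasCompactSupport.of_compactSpace _))
    _ ≤ A * ∫ x, (trig c x).re ^ p ∂circMeasure := by
        have := mul_nonneg hB hmv0
        linarith

end PositivePolynomials

/-! ### The inequality of M. Riesz for trigonometric polynomials -/

section RieszProjection

theorem norm_trigLp (p : ℝ≥0∞) [Fact (1 ≤ p)] (hp : p ≠ ∞) (c : ℤ →₀ ℂ) :
    ‖trigLp p c‖ = (∫ x, ‖trig c x‖ ^ p.toReal ∂circMeasure) ^ p.toReal⁻¹ := by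
  have hp0 : p ≠ 0 := (one_pos.trans_le (Fact.out : 1 ≤ p)).ne'
  rw [Lp.norm_def, eLpNorm_congr_ae (coeFn_trigLp p c),
    (memLp_of_continuous (trig c).continuous p).eLpNorm_eq_integral_rpow_norm hp0 hp,
    ENNReal.toReal_ofReal (by positivity)]

theorem norm_trigLp_le (p : ℝ≥0∞) [Fact (1 ≤ p)] (c : ℤ →₀ ℂ) {C : ℝ} (hC : 0 ≤ C)
    (h : ∀ x, ‖trig c x‖ ≤ C) : ‖trigLp p c‖ ≤ C := by
  have := Lp.norm_le_of_ae_bound (f := trigLp p c) hC (by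
    filter_upwards [coeFn_trigLp p c] with x hx
    rw [hx]
    exact h x)
  simpa [measureUnivNNReal, probReal_univ] using this

theorem norm_trigLp_mono (p : ℝ≥0∞) [Fact (1 ≤ p)] {c d : ℤ →₀ ℂ} {δ : ℝ} (hδ : 0 ≤ δ)
    (h : ∀ x, ‖trig c x‖ ≤ ‖trig d x‖ + δ) : ‖trigLp p c‖ ≤ ‖trigLp p d‖ + δ := by
  have h1 : eLpNorm (trig c) p circMeasure ≤
      eLpNorm (fun x => ‖trig d x‖ + δ) p circMeasure :=
    eLpNorm_mono_real h
  have h2 : eLpNorm (fun x => ‖trig d x‖ + δ) p circMeasure ≤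
      eLpNorm (trig d) p circMeasure + ENNReal.ofReal δ := by
    refine (eLpNorm_add_le (trig d).continuous.norm.aestronglyMeasurable
      aestronglyMeasurable_const Fact.out).trans ?_
    rw [eLpNorm_norm]
    gcongr
    refine (eLpNorm_le_of_ae_bound (C := δ) (Eventually.of_forall fun x => ?_)).trans ?_
    · rw [Real.norm_of_nonneg hδ]
    · simp
  have hd : eLpNorm (trig d) p circMeasure ≠ ∞ :=
    (memLp_of_continuous (trig d).continuous p).2.ne
  rw [Lp.norm_def, Lp.norm_def, eLpNorm_congr_ae (coeFn_trigLp p c),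
    eLpNorm_congr_ae (coeFn_trigLp p d)]
  refine (ENNReal.toReal_mono (by finiteness) (h1.trans h2)).trans ?_
  rw [ENNReal.toReal_add hd ENNReal.ofReal_ne_top, ENNReal.toReal_ofReal hδ]

theorem norm_trigLp_two_analyticPart_le (c : ℤ →₀ ℂ) :
    ‖trigLp 2 (analyticPart c)‖ ≤ ‖trigLp 2 c‖ := by
  have hn : ∀ d, ‖trigLp 2 d‖ ^ 2 = ∫ x, ‖trigLp 2 d x‖ ^ 2 ∂circMeasure := by
    intro d
    have h0 : 0 ≤ ∫ x, ‖trig d x‖ ^ 2 ∂circMeasure := integral_nonneg fun x => by positivity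
    have h1 : ∫ x, ‖trigLp 2 d x‖ ^ 2 ∂circMeasure = ∫ x, ‖trig d x‖ ^ 2 ∂circMeasure :=
      integral_congr_ae (by
        filter_upwards [coeFn_trigLp 2 d] with x hx
        rw [hx])
    rw [h1, norm_trigLp 2 (by simp)]
    simp only [ENNReal.toReal_ofNat, Real.rpow_ofNat]
    rw [← one_div, ← Real.sqrt_eq_rpow, Real.sq_sqrt h0]
  have hs : ∀ d : ℤ →₀ ℂ, HasSum (fun i => ‖d i‖ ^ 2) (‖trigLp 2 d‖ ^ 2) := by
    intro d
    rw [hn]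
    convert hasSum_sq_fourierCoeff (trigLp 2 d) using 4 with i
    rw [fourierCoeff_congr (coeFn_trigLp 2 d), fourierCoeff_trig]
  have := hasSum_le (fun i => ?_) (hs (analyticPart c)) (hs c)
  · exact le_of_sq_le_sq this (norm_nonneg _)
  · rw [analyticPart_apply]
    split_ifs
    · exact le_rfl
    · simp

/-- A continuous function `g ≥ 0` is a uniform limit of positive trigonometric polynomials, namely
of squares `|r| ^ 2` where `r` approximates `√g`, plus small constants. -/
theorem exists_positive_trig (g : Circ → ℝ) (hg : Continuous g) (hg0 : ∀ x, 0 ≤ g x) {δ : ℝ}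
    (hδ : 0 < δ) : ∃ c : ℤ →₀ ℂ, (∀ x, (trig c x).im = 0) ∧ (∀ x, δ / 2 ≤ (trig c x).re) ∧
      ∀ x, ‖trig c x - g x‖ ≤ δ := by
  obtain ⟨h, hh⟩ : ∃ h : C(Circ, ℂ), ∀ x, h x = ((√(g x) : ℝ) : ℂ) :=
    ⟨⟨fun x => ((√(g x) : ℝ) : ℂ), by fun_prop⟩, fun _ => rfl⟩
  have hcont : Continuous fun r : C(Circ, ℂ) => r * star r := by fun_prop
  obtain ⟨η, hη, hηd⟩ := Metric.continuous_iff.1 hcont h (δ / 2) (half_pos hδ)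
  obtain ⟨d, hd⟩ := denseRange_trig.exists_dist_lt h hη
  have hmem : ∀ e, trig e ∈ (fourierSubalgebra (T := 1)) := fun e => by
    have : trig e ∈ Subalgebra.toSubmodule (fourierSubalgebra (T := 1)).toSubalgebra := by
      rw [fourierSubalgebra_coe]
      change trig e ∈ trigPoly
      rw [← range_trig]
      exact LinearMap.mem_range_self trig e
    exact this
  have hmem2 : trig d * star (trig d) ∈ (fourierSubalgebra (T := 1)) :=
    mul_mem (hmem d) (star_mem (hmem d))
  obtain ⟨e, he⟩ : ∃ e, trig e = trig d * star (trig d) := by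
    have : trig d * star (trig d) ∈
        Subalgebra.toSubmodule (fourierSubalgebra (T := 1)).toSubalgebra := hmem2
    rw [fourierSubalgebra_coe] at this
    change _ ∈ trigPoly at this
    rw [← range_trig] at this
    exact this
  have heval : ∀ x, trig e x = ((‖trig d x‖ ^ 2 : ℝ) : ℂ) := fun x => by
    rw [he, ContinuousMap.mul_apply, ContinuousMap.star_apply, ← starRingEnd_apply, mul_conj,
      normSq_eq_norm_sq]
  have hc : ∀ x, trig (e + Finsupp.single 0 ((δ / 2 : ℝ) : ℂ)) x =
      ((‖trig d x‖ ^ 2 + δ / 2 : ℝ) : ℂ) := fun x => by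
    rw [map_add, ContinuousMap.add_apply, trig_single, tpow_zero, mul_one, heval]
    push_cast
    ring
  refine ⟨e + Finsupp.single 0 ((δ / 2 : ℝ) : ℂ), fun x => ?_, fun x => ?_, fun x => ?_⟩
  · rw [hc, ofReal_im]
  · rw [hc, ofReal_re]
    nlinarith [sq_nonneg ‖trig d x‖]
  · have hball : dist (trig d * star (trig d)) (h * star h) < δ / 2 :=
      hηd _ (by rwa [dist_comm])
    have h1 := (ContinuousMap.dist_apply_le_dist (f := trig d * star (trig d))
      (g := h * star h) x).trans hball.le
    have h2 : (h * star h) x = g x := by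
      rw [ContinuousMap.mul_apply, ContinuousMap.star_apply, hh, ← starRingEnd_apply, conj_ofReal,
      ← ofReal_mul, Real.mul_self_sqrt (hg0 x)]
    rw [← he, heval, h2, dist_eq_norm] at h1
    rw [hc]
    calc ‖((‖trig d x‖ ^ 2 + δ / 2 : ℝ) : ℂ) - g x‖
        = ‖(((‖trig d x‖ ^ 2 : ℝ) : ℂ) - g x) + ((δ / 2 : ℝ) : ℂ)‖ := by
          congr 1
          push_cast
          ring
      _ ≤ δ / 2 + δ / 2 := by
          refine (norm_add_le _ _).trans (add_le_add h1 ?_)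
          rw [norm_real, Real.norm_of_nonneg (by positivity)]
      _ = δ := by ring

theorem exists_norm_analyticPart_le_of_pos {p : ℝ≥0∞} [Fact (1 ≤ p)] (hp1 : 1 < p) (hp2 : p ≤ 2) :
    ∃ C : ℝ, 0 ≤ C ∧ ∀ (c : ℤ →₀ ℂ) (ε : ℝ), 0 < ε → (∀ x, (trig c x).im = 0) →
      (∀ x, ε ≤ (trig c x).re) → ‖trigLp p (analyticPart c)‖ ≤ C * ‖trigLp p c‖ := by
  have hp : p ≠ ∞ := (hp2.trans_lt (by simp)).ne
  have hr1 : 1 < p.toReal := by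
    rw [← ENNReal.toReal_one]
    exact (ENNReal.toReal_lt_toReal ENNReal.one_ne_top hp).2 hp1
  have hr2 : p.toReal ≤ 2 := by
    have := ENNReal.toReal_mono (by simp) hp2
    simpa using this
  obtain ⟨A, B, hA, hB, hAB⟩ := exists_norm_rpow_le hr1 hr2
  refine ⟨(A ^ p.toReal⁻¹ + 1) / 2, by positivity, fun c ε hε hr hpos => ?_⟩
  have h1 := integral_analyticPart_le hr1 hB hAB c hr hε hpos
  have e1 : ∀ x, ‖trig c x‖ = (trig c x).re := fun x => by
    have : trig c x = ((trig c x).re : ℂ) := Complex.ext rfl (by simpa using hr x)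
    rw [this, norm_real, Real.norm_of_nonneg (hε.le.trans (hpos x)), ofReal_re]
  have e2 : ∀ x, trig ((2 : ℂ) • analyticPart c - Finsupp.single 0 (c 0)) x =
      2 * trig (analyticPart c) x - c 0 := fun x => by
    rw [map_sub, map_smul, ContinuousMap.sub_apply, trig_single, tpow_zero, mul_one]
    rfl
  have h2 : ‖trigLp p ((2 : ℂ) • analyticPart c - Finsupp.single 0 (c 0))‖ ≤
      A ^ p.toReal⁻¹ * ‖trigLp p c‖ := by
    rw [norm_trigLp p hp, norm_trigLp p hp, ← Real.mul_rpow hA (by positivity)]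
    refine Real.rpow_le_rpow (by positivity) ?_ (by positivity)
    simp only [e2, e1]
    exact h1
  have h3 : ‖trigLp p (Finsupp.single 0 (c 0))‖ ≤ ‖trigLp p c‖ := by
    refine (norm_trigLp_le p _ (norm_nonneg (c 0)) fun x => ?_).trans ?_
    · rw [trig_single, tpow_zero, mul_one]
    · rw [← fourierCoeff_trig c 0, ← fourierCoeff_congr (coeFn_trigLp p c)]
      exact (norm_fourierCoeff_le 0).trans (integral_norm_le_norm _)
  have h4 : trigLp p (analyticPart c) = (2⁻¹ : ℂ) •
      (trigLp p ((2 : ℂ) • analyticPart c - Finsupp.single 0 (c 0)) +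
        trigLp p (Finsupp.single 0 (c 0))) := by
    rw [← map_add, sub_add_cancel, map_smul, smul_smul]
    norm_num
  rw [h4, norm_smul]
  have h5 := (norm_add_le (trigLp p ((2 : ℂ) • analyticPart c - Finsupp.single 0 (c 0)))
    (trigLp p (Finsupp.single 0 (c 0)))).trans (add_le_add h2 h3)
  have h6 : ‖(2⁻¹ : ℂ)‖ = 2⁻¹ := by norm_num
  rw [h6]
  linarith

/-- The inequality of M. Riesz for trigonometric polynomials, `1 < p ≤ 2`. A polynomial is split
into the positive and negative parts of its real and imaginary parts, each of which is approximated
uniformly by positive trigonometric polynomials; the remainder is controlled in `L^2`. -/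
theorem exists_norm_analyticPart_le {p : ℝ≥0∞} [Fact (1 ≤ p)] (hp1 : 1 < p) (hp2 : p ≤ 2) :
    ∃ C : ℝ, ∀ c : ℤ →₀ ℂ, ‖trigLp p (analyticPart c)‖ ≤ C * ‖trigLp p c‖ := by
  obtain ⟨C, hC0, hC⟩ := exists_norm_analyticPart_le_of_pos hp1 hp2
  refine ⟨4 * C, fun c => ?_⟩
  refine le_of_forall_pos_le_add fun η hη => ?_
  obtain ⟨δ, hδ, hδη⟩ : ∃ δ : ℝ, 0 < δ ∧ 4 * C * δ + 4 * δ ≤ η :=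
    ⟨η / (4 * C + 4), by positivity, le_of_eq (by field_simp)⟩
  have piece : ∀ g : Circ → ℝ, Continuous g → (∀ x, 0 ≤ g x) → (∀ x, g x ≤ ‖trig c x‖) →
      ∃ d : ℤ →₀ ℂ, ‖trigLp p (analyticPart d)‖ ≤ C * (‖trigLp p c‖ + δ) ∧
        ∀ x, ‖trig d x - g x‖ ≤ δ := by
    intro g hg hg0 hgc
    obtain ⟨d, hd1, hd2, hd3⟩ := exists_positive_trig g hg hg0 hδ
    refine ⟨d, (hC d (δ / 2) (by positivity) hd1 hd2).trans
      (mul_le_mul_of_nonneg_left (norm_trigLp_mono p hδ.le fun x => ?_) hC0), hd3⟩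
    have h1 : ‖trig d x‖ ≤ ‖trig d x - g x‖ + ‖(g x : ℂ)‖ := by
      simpa using norm_add_le (trig d x - g x) (g x : ℂ)
    rw [norm_real, Real.norm_of_nonneg (hg0 x)] at h1
    linarith [hd3 x, hgc x]
  obtain ⟨d1, hd1, hd1'⟩ := piece (fun x => max (trig c x).re 0) (by fun_prop)
    (fun x => le_max_right _ _) fun x => max_le ((le_abs_self _).trans (abs_re_le_norm _))
      (norm_nonneg _)
  obtain ⟨d2, hd2, hd2'⟩ := piece (fun x => max (-(trig c x).re) 0) (by fun_prop)
    (fun x => le_max_right _ _) fun x => max_le ((neg_le_abs _).trans (abs_re_le_norm _))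
      (norm_nonneg _)
  obtain ⟨d3, hd3, hd3'⟩ := piece (fun x => max (trig c x).im 0) (by fun_prop)
    (fun x => le_max_right _ _) fun x => max_le ((le_abs_self _).trans (abs_im_le_norm _))
      (norm_nonneg _)
  obtain ⟨d4, hd4, hd4'⟩ := piece (fun x => max (-(trig c x).im) 0) (by fun_prop)
    (fun x => le_max_right _ _) fun x => max_le ((neg_le_abs _).trans (abs_im_le_norm _))
      (norm_nonneg _)
  set e : ℤ →₀ ℂ := c - (d1 - d2 + I • d3 - I • d4) with he
  have hex : ∀ x, ‖trig e x‖ ≤ 4 * δ := by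
    intro x
    have hsplit : trig c x = ((max (trig c x).re 0 : ℝ) : ℂ) - ((max (-(trig c x).re) 0 : ℝ) : ℂ) +
        I * ((max (trig c x).im 0 : ℝ) : ℂ) - I * ((max (-(trig c x).im) 0 : ℝ) : ℂ) := by
      have hm : ∀ a : ℝ, max a 0 - max (-a) 0 = a := fun a => by
        rcases le_total a 0 with h | h
        · rw [max_eq_right h, max_eq_left (by linarith)]; ring
        · rw [max_eq_left h, max_eq_right (by linarith)]; ring
      rw [add_sub_assoc, ← mul_sub, ← ofReal_sub, ← ofReal_sub, hm, hm, mul_comm, re_add_im]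
    have h1 : trig e x = -(trig d1 x - ((max (trig c x).re 0 : ℝ) : ℂ)) +
        (trig d2 x - ((max (-(trig c x).re) 0 : ℝ) : ℂ)) +
        -(I * (trig d3 x - ((max (trig c x).im 0 : ℝ) : ℂ))) +
        I * (trig d4 x - ((max (-(trig c x).im) 0 : ℝ) : ℂ)) := by
      have : trig e x = trig c x - (trig d1 x - trig d2 x + I * trig d3 x - I * trig d4 x) := by
        rw [he, map_sub, map_sub, map_add, map_sub, map_smul, map_smul]
        rfl
      rw [this]
      nth_rewrite 1 [hsplit]
      ring
    rw [h1]
    refine (norm_add_le _ _).trans ?_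
    refine (add_le_add (norm_add₃_le) le_rfl).trans ?_
    rw [norm_neg, norm_neg, norm_mul, norm_mul, norm_I, one_mul, one_mul]
    linarith [hd1' x, hd2' x, hd3' x, hd4' x]
  have heP : ‖trigLp p (analyticPart e)‖ ≤ 4 * δ := by
    have h1 : ‖trigLp p (analyticPart e)‖ ≤ ‖trigLp 2 (analyticPart e)‖ := by
      rw [Lp.norm_def, Lp.norm_def, eLpNorm_congr_ae (coeFn_trigLp p _),
        eLpNorm_congr_ae (coeFn_trigLp 2 _)]
      exact ENNReal.toReal_mono (memLp_of_continuous (trig _).continuous 2).2.ne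
        (eLpNorm_le_eLpNorm_of_exponent_le hp2 (trig _).continuous.aestronglyMeasurable)
    exact (h1.trans (norm_trigLp_two_analyticPart_le e)).trans
      (norm_trigLp_le 2 e (by positivity) hex)
  have hsum : analyticPart c = analyticPart e + analyticPart d1 + (-1 : ℂ) • analyticPart d2 +
      I • analyticPart d3 + (-I) • analyticPart d4 := by
    rw [← analyticPart_smul, ← analyticPart_smul, ← analyticPart_smul, ← analyticPart_add,
      ← analyticPart_add, ← analyticPart_add, ← analyticPart_add]
    congr 1
    rw [he]
    module
  rw [hsum, map_add, map_add, map_add, map_add, map_smul, map_smul, map_smul]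
  refine (norm_add_le _ _).trans ?_
  refine (add_le_add (norm_add_le _ _) le_rfl).trans ?_
  refine (add_le_add (add_le_add norm_add₃_le le_rfl) le_rfl).trans ?_
  rw [norm_smul, norm_smul, norm_smul, norm_neg, norm_neg, norm_I, norm_one, one_mul, one_mul,
    one_mul]
  linarith

end RieszProjection

/-! ### The Riesz projection and products of analytic functions -/

section RieszOperator

variable {p q : ℝ≥0∞}

theorem Lp_ext_fourierCoeff [Fact (1 ≤ p)] {f g : Lp ℂ p circMeasure}
    (h : ∀ n, fourierCoeff f n = fourierCoeff g n) : f = g :=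
  Lp.ext (ae_eq_of_fourierCoeff (integrable_coe p f) (integrable_coe p g) h)

theorem IsRieszProjection.congr {f f' g g' : Circ → ℂ} (h : IsRieszProjection f g)
    (hf : f =ᵐ[circMeasure] f') (hg : g =ᵐ[circMeasure] g') : IsRieszProjection f' g' :=
  ⟨h.1.congr hf, h.2.1.congr hg, fun n => by
    rw [← fourierCoeff_congr hf, ← fourierCoeff_congr hg, h.2.2]⟩

theorem IsRieszProjection.unique {f g g' : Circ → ℂ} (h : IsRieszProjection f g)
    (h' : IsRieszProjection f g') : g =ᵐ[circMeasure] g' :=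
  ae_eq_of_fourierCoeff h.2.1 h'.2.1 fun n => by rw [h.2.2, h'.2.2]

theorem coeffCLM_trigLp [Fact (1 ≤ p)] (c : ℤ →₀ ℂ) (n : ℤ) :
    coeffCLM p n (trigLp p c) = c n := by
  rw [coeffCLM_apply, fourierCoeff_congr (coeFn_trigLp p c), fourierCoeff_trig]

/-- Bounded operators on `L^p` that agree on the monomials are equal. -/
theorem clm_ext_monomial [Fact (1 ≤ p)] (hp : p ≠ ∞) {E : Type*} [NormedAddCommGroup E]
    [NormedSpace ℂ E] {S T : Lp ℂ p circMeasure →L[ℂ] E}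
    (h : ∀ n, S (trigLp p (Finsupp.single n 1)) = T (trigLp p (Finsupp.single n 1))) : S = T := by
  have h1 : S.toLinearMap.comp (trigLp p) = T.toLinearMap.comp (trigLp p) := by
    ext n
    simpa using h n
  ext1 f
  refine congrFun ((denseRange_trigLp hp).equalizer S.continuous T.continuous ?_) f
  funext c
  exact congrArg (fun L : (ℤ →₀ ℂ) →ₗ[ℂ] E => L c) h1

theorem coeFn_monomial (p : ℝ≥0∞) [Fact (1 ≤ p)] (n : ℤ) :
    trigLp p (Finsupp.single n 1) =ᵐ[circMeasure] tpow n := by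
  filter_upwards [coeFn_trigLp p (Finsupp.single n 1)] with x hx
  rw [hx, trig_single, one_mul]

/-- The theorem of M. Riesz in the range `1 < p ≤ 2`. -/
theorem exists_rieszProjection_of_le_two [Fact (1 ≤ p)] (hp1 : 1 < p) (hp2 : p ≤ 2)
    (f : Lp ℂ p circMeasure) : ∃ g : Lp ℂ p circMeasure, IsRieszProjection f g := by
  have hp : p ≠ ∞ := (hp2.trans_lt (by simp)).ne
  obtain ⟨C, hC⟩ := exists_norm_analyticPart_le hp1 hp2
  obtain ⟨u, hu, hlim⟩ := mem_closure_iff_seq_limit.1 (denseRange_trigLp hp f)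
  choose c hc using hu
  have hcauchy : CauchySeq fun k => trigLp p (analyticPart (c k)) := by
    have h1 : CauchySeq fun k => trigLp p (c k) := by
      simp only [hc]
      exact hlim.cauchySeq
    rw [Metric.cauchySeq_iff] at h1 ⊢
    intro ε hε
    obtain ⟨N, hN⟩ := h1 (ε / (|C| + 1)) (by positivity)
    refine ⟨N, fun m hm n hn => ?_⟩
    have h2 := hN m hm n hn
    rw [dist_eq_norm, ← map_sub, lt_div_iff₀ (by positivity)] at h2
    have h3 : analyticPart (c m) - analyticPart (c n) = analyticPart (c m - c n) :=
      Finsupp.ext fun k => by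
        simp only [Finsupp.sub_apply, analyticPart_apply]
        split_ifs <;> simp
    rw [dist_eq_norm, ← map_sub, h3]
    have h4 := hC (c m - c n)
    have h5 := mul_le_mul_of_nonneg_right (le_abs_self C) (norm_nonneg (trigLp p (c m - c n)))
    nlinarith [norm_nonneg (trigLp p (c m - c n))]
  obtain ⟨g, hg⟩ := cauchySeq_tendsto_of_complete hcauchy
  refine ⟨g, integrable_coe p f, integrable_coe p g, fun n => ?_⟩
  have h1 := ((coeffCLM p n).continuous.tendsto g).comp hg
  have h2 := ((coeffCLM p n).continuous.tendsto f).comp hlim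
  simp only [Function.comp_def, coeffCLM_trigLp, analyticPart_apply] at h1
  simp only [Function.comp_def, ← hc, coeffCLM_trigLp] at h2
  split_ifs with hn
  · simp only [hn, if_true] at h1
    exact tendsto_nhds_unique h1 h2
  · simp only [hn, if_false] at h1
    exact (tendsto_nhds_unique h1 tendsto_const_nhds)

/-- If every `f ∈ L^p` has a Riesz projection in `L^p`, the projection is bounded, by the closed
graph theorem. -/
theorem exists_rieszCLM_of_exists [Fact (1 ≤ p)]
    (h : ∀ f : Lp ℂ p circMeasure, ∃ g : Lp ℂ p circMeasure, IsRieszProjection f g) :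
    ∃ P : Lp ℂ p circMeasure →L[ℂ] Lp ℂ p circMeasure, 
      ∀ f : Lp ℂ p circMeasure, IsRieszProjection f (P f) := by
  choose P hP using h
  have hPn : ∀ f n, coeffCLM p n (P f) = if 0 ≤ n then coeffCLM p n f else 0 :=
    fun f n => (hP f).2.2 n
  let L : Lp ℂ p circMeasure →ₗ[ℂ] Lp ℂ p circMeasure :=
    { toFun := P
      map_add' := fun f g => Lp_ext_fourierCoeff fun n => by
        rw [← coeffCLM_apply, ← coeffCLM_apply, hPn, map_add, map_add, hPn, hPn]
        split_ifs <;> simp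
      map_smul' := fun a f => Lp_ext_fourierCoeff fun n => by
        rw [← coeffCLM_apply, ← coeffCLM_apply, hPn, map_smul, RingHom.id_apply, map_smul, hPn]
        split_ifs <;> simp }
  have hL : Continuous L := L.continuous_of_seq_closed_graph fun u f g hu hLu => by
    refine Lp_ext_fourierCoeff fun n => ?_
    have h1 := ((coeffCLM p n).continuous.tendsto g).comp hLu
    have h2 := ((coeffCLM p n).continuous.tendsto f).comp hu
    have h3 : ∀ k, coeffCLM p n (L (u k)) = if 0 ≤ n then coeffCLM p n (u k) else 0 :=
      fun k => hPn _ _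
    have h4 : fourierCoeff (L f) n = if 0 ≤ n then coeffCLM p n f else 0 := hPn _ _
    rw [h4]
    simp only [Function.comp_def, h3] at h1 h2
    split_ifs with hn
    · simp only [hn, if_true] at h1
      exact tendsto_nhds_unique h1 h2
    · simp only [hn, if_false] at h1
      exact tendsto_nhds_unique h1 tendsto_const_nhds
  exact ⟨⟨L, hL⟩, hP⟩

/-- The substitution `t ↦ t⁻¹` as an operator on `L^p`. -/
noncomputable def negCLM (p : ℝ≥0∞) [Fact (1 ≤ p)] :
    Lp ℂ p circMeasure →L[ℂ] Lp ℂ p circMeasure :=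
  (Lp.compMeasurePreservingₗᵢ ℂ (fun x : Circ => -x)
    (Measure.measurePreserving_neg circMeasure)).toContinuousLinearMap

theorem coeFn_negCLM [Fact (1 ≤ p)] (f : Lp ℂ p circMeasure) :
    negCLM p f =ᵐ[circMeasure] fun x => f (-x) :=
  Lp.coeFn_compMeasurePreserving f (Measure.measurePreserving_neg circMeasure)

/-- The theorem of M. Riesz for `1 < p < ∞`. The range `p > 2` follows by duality: the functional
`g ↦ ∫ f · P' g` on `L^q`, where `P'` is the projection to the indices `n ≤ 0`, is represented by
the Riesz projection of `f`. -/
theorem exists_rieszCLM [Fact (1 ≤ p)] (hp1 : 1 < p) (hp : p < ∞) :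
    ∃ P : Lp ℂ p circMeasure →L[ℂ] Lp ℂ p circMeasure, 
      ∀ f : Lp ℂ p circMeasure, IsRieszProjection f (P f) := by
  refine exists_rieszCLM_of_exists fun f => ?_
  rcases le_total p 2 with h2 | h2
  · exact exists_rieszProjection_of_le_two hp1 h2 f
  obtain ⟨q, hq⟩ : ∃ q, q = (1 - p⁻¹)⁻¹ := ⟨_, rfl⟩
  have hpq : ENNReal.HolderConjugate p q := by
    rw [ENNReal.holderConjugate_iff, hq, inv_inv]
    exact add_tsub_cancel_of_le (ENNReal.inv_le_one.2 hp1.le)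
  have hq1 : 1 < q := (ENNReal.HolderConjugate.lt_top_iff_one_lt p q).1 hp
  have hqt : q < ∞ := (ENNReal.HolderConjugate.lt_top_iff_one_lt q p).2 hp1
  have : Fact (1 ≤ q) := ⟨hq1.le⟩
  have hq2 : q ≤ 2 := by
    have h3 : p⁻¹ ≤ 2⁻¹ := ENNReal.inv_le_inv.2 h2
    rw [hq, ENNReal.inv_le_iff_inv_le]
    refine ENNReal.le_sub_of_add_le_left (by finiteness) ?_
    refine (add_le_add_left h3 _).trans ?_
    rw [ENNReal.inv_two_add_inv_two]
  obtain ⟨Q, hQ⟩ := exists_rieszCLM_of_exists (exists_rieszProjection_of_le_two hq1 hq2)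
  obtain ⟨g, hg, hrep⟩ := exists_memLp_representation (q := p) hq1 hqt
    ((pairCLM q (Lp.memLp f)).comp ((negCLM q).comp (Q.comp (negCLM q))))
  refine ⟨hg.toLp, IsRieszProjection.congr (f := f) (g := g) ⟨integrable_coe p f,
    hg.integrable hp1.le, fun n => ?_⟩ .rfl hg.coeFn_toLp.symm⟩
  have hmon : negCLM q (trigLp q (Finsupp.single (-n) 1)) = trigLp q (Finsupp.single n 1) := by
    refine Lp.ext ?_
    filter_upwards [coeFn_negCLM (trigLp q (Finsupp.single (-n) 1)),
      ae_neg (coeFn_monomial q (-n)), coeFn_monomial q n] with x h1 h2 h3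
    rw [h1, h2, h3, tpow_neg_arg, neg_neg]
  have hQn : Q (trigLp q (Finsupp.single n 1)) =
      if 0 ≤ n then trigLp q (Finsupp.single n 1) else 0 := by
    refine Lp_ext_fourierCoeff fun m => ?_
    rw [(hQ _).2.2, ← coeffCLM_apply, ← coeffCLM_apply, coeffCLM_trigLp, apply_ite (coeffCLM q m),
      coeffCLM_trigLp, map_zero, Finsupp.single_apply]
    by_cases hm : n = m
    · subst hm; simp
    · simp [hm]
  have h1 := hrep (trigLp q (Finsupp.single (-n) 1))
  simp only [ContinuousLinearMap.comp_apply, hmon, hQn, apply_ite (negCLM q), map_zero] at h1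
  have hmon' : negCLM q (trigLp q (Finsupp.single n 1)) = trigLp q (Finsupp.single (-n) 1) := by
    refine Lp.ext ?_
    filter_upwards [coeFn_negCLM (trigLp q (Finsupp.single n 1)),
      ae_neg (coeFn_monomial q n), coeFn_monomial q (-n)] with x h1 h2 h3
    rw [h1, h2, h3, tpow_neg_arg]
  have hint : ∀ k : Circ → ℂ, ∫ x, trigLp q (Finsupp.single (-n) 1) x * k x ∂circMeasure =
      fourierCoeff k n := fun k => by
    rw [fourierCoeff_def]
    refine integral_congr_ae ?_
    filter_upwards [coeFn_monomial q (-n)] with x hx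
    rw [hx]
  rw [hint] at h1
  rw [← h1]
  split_ifs
  · rw [hmon', pairCLM_apply, hint]
  · rw [map_zero]

theorem holderConjugate_one_lt [ENNReal.HolderConjugate p q] (hp : p < ∞) : 1 < q :=
  (ENNReal.HolderConjugate.lt_top_iff_one_lt p q).1 hp

theorem integrable_mul_of_memLp [ENNReal.HolderConjugate p q] {a b : Circ → ℂ}
    (ha : MemLp a p circMeasure) (hb : MemLp b q circMeasure) :
    Integrable (fun x => a x * b x) circMeasure := ha.integrable_mul hb

/-- The product of functions in `H^p` and `H^q` is analytic, with the expected mean. -/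
theorem fourierCoeff_mul_of_memHardy [ENNReal.HolderConjugate p q] (hp1 : 1 < p) (hp : p < ∞)
    {a b : Circ → ℂ} (ha : MemHardy p a) (hb : MemHardy q b) {k : ℤ} (hk : k ≤ 0) :
    fourierCoeff (fun x => a x * b x) k =
      if k = 0 then fourierCoeff a 0 * fourierCoeff b 0 else 0 := by
  have hq1 : 1 < q := holderConjugate_one_lt (p := p) hp
  have hqt : q < ∞ := (ENNReal.HolderConjugate.lt_top_iff_one_lt q p).2 hp1
  have : Fact (1 ≤ p) := ⟨hp1.le⟩
  have : Fact (1 ≤ q) := ⟨hq1.le⟩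
  obtain ⟨Q, hQ⟩ := exists_rieszCLM (p := q) hq1 hqt
  -- The identity holds for `a · Q b` with any `b ∈ L^q`, by continuity from monomials.
  have key : (pairCLM q (memLp_tpow_mul ha.1 (-k))).comp Q =
      (if k = 0 then fourierCoeff a 0 else 0) • coeffCLM q 0 := by
    refine clm_ext_monomial hqt.ne fun n => ?_
    rw [ContinuousLinearMap.comp_apply, _root_.smul_apply, coeffCLM_trigLp]
    rcases lt_or_ge n 0 with hn | hn
    · have : Q (trigLp q (Finsupp.single n 1)) = 0 := by
        refine Lp_ext_fourierCoeff fun m => ?_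
        rw [(hQ _).2.2, ← coeffCLM_apply, ← coeffCLM_apply, coeffCLM_trigLp, map_zero,
          Finsupp.single_apply]
        by_cases hm : n = m
        · subst hm; simp [hn]
        · simp [hm]
      rw [this, map_zero, Finsupp.single_apply, if_neg hn.ne, smul_zero]
    · have : Q (trigLp q (Finsupp.single n 1)) = trigLp q (Finsupp.single n 1) := by
        refine Lp_ext_fourierCoeff fun m => ?_
        rw [(hQ _).2.2, ← coeffCLM_apply, coeffCLM_trigLp, Finsupp.single_apply]
        by_cases hm : n = m
        · subst hm; simp [hn]
        · simp [hm]
      rw [this, pairCLM_apply]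
      have e : ∫ x, trigLp q (Finsupp.single n 1) x * (tpow (-k) x * a x) ∂circMeasure =
          fourierCoeff a (k - n) := by
        rw [fourierCoeff_def]
        refine integral_congr_ae ?_
        filter_upwards [coeFn_monomial q n] with x hx
        rw [hx, ← mul_assoc, ← tpow_add]
        congr 2
        ring
      rw [e, Finsupp.single_apply]
      rcases eq_or_lt_of_le hn with h0 | h0
      · subst h0
        rcases eq_or_lt_of_le hk with h1 | h1
        · simp [h1]
        · simp [h1.ne, ha.2 k h1]
      · rw [if_neg h0.ne', smul_zero, ha.2 _ (by omega)]
  have hbQ : Q hb.1.toLp = hb.1.toLp := by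
    refine Lp_ext_fourierCoeff fun n => ?_
    rw [(hQ _).2.2, fourierCoeff_congr hb.1.coeFn_toLp]
    split_ifs with h
    · rfl
    · rw [hb.2 n (not_le.1 h)]
  have h1 := congrArg (fun L : Lp ℂ q circMeasure →L[ℂ] ℂ => L hb.1.toLp) key
  simp only [ContinuousLinearMap.comp_apply, hbQ, _root_.smul_apply, pairCLM_apply,
    coeffCLM_apply, fourierCoeff_congr hb.1.coeFn_toLp, smul_eq_mul, ite_mul, zero_mul] at h1
  rw [← h1, fourierCoeff_def]
  refine integral_congr_ae ?_
  filter_upwards [hb.1.coeFn_toLp] with x hx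
  rw [hx]
  ring

/-- The product of functions of `L^p` and `L^q` with spectra bounded above has spectrum bounded
above, with the expected top coefficient. -/
theorem fourierCoeff_mul_of_le [ENNReal.HolderConjugate p q] (hp1 : 1 < p) (hp : p < ∞)
    {a b : Circ → ℂ} (ha : MemLp a p circMeasure) (hb : MemLp b q circMeasure) {M N : ℤ}
    (haM : ∀ n, M < n → fourierCoeff a n = 0) (hbN : ∀ n, N < n → fourierCoeff b n = 0) {n : ℤ}
    (hn : M + N ≤ n) :
    fourierCoeff (fun x => a x * b x) n =
      if n = M + N then fourierCoeff a M * fourierCoeff b N else 0 := by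
  have hc : ∀ (f : Circ → ℂ) (K m : ℤ),
      fourierCoeff (fun x => tpow K x * f (-x)) m = fourierCoeff f (K - m) := fun f K m => by
    rw [fourierCoeff_tpow_mul K (fun x => f (-x)) m, fourierCoeff_neg_arg, neg_sub]
  have h := fourierCoeff_mul_of_memHardy hp1 hp (k := M + N - n)
    (a := fun x => tpow M x * a (-x)) (b := fun x => tpow N x * b (-x))
    ⟨memLp_tpow_mul (memLp_neg_arg ha) M, fun m hm => by rw [hc, haM _ (by omega)]⟩
    ⟨memLp_tpow_mul (memLp_neg_arg hb) N, fun m hm => by rw [hc, hbN _ (by omega)]⟩ (by omega)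
  have e : (fun x => tpow M x * a (-x) * (tpow N x * b (-x))) =
      fun x => tpow (M + N) x * (fun y => a y * b y) (-x) := by
    funext x
    simp only [tpow_add]
    ring
  rw [e, hc (fun y => a y * b y), hc, hc, sub_sub_cancel, sub_zero, sub_zero] at h
  rw [h]
  by_cases h0 : n = M + N
  · simp [h0]
  · rw [if_neg h0, if_neg (by omega)]

end RieszOperator

/-! ### Toeplitz and Hankel operators -/

section ToeplitzHankel

variable {p q : ℝ≥0∞}

/-- Points are null sets: the Fourier coefficients of the indicator of a point all have the same
modulus, the measure of the point, and the Riemann–Lebesgue lemma applies. -/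
theorem circMeasure_singleton (x : Circ) : circMeasure {x} = 0 := by
  set f : Circ → ℂ := ({x} : Set Circ).indicator fun _ => 1 with hf
  have hfi : Integrable f circMeasure :=
    (integrable_const 1).indicator (measurableSet_singleton x)
  have hn : ∀ n : ℤ, ‖fourierCoeff f n‖ = circMeasure.real {x} := fun n => by
    have e : (fun y => tpow (-n) y * f y) = ({x} : Set Circ).indicator (tpow (-n)) := by
      funext y
      by_cases hy : y ∈ ({x} : Set Circ)
      · rw [hf, Set.indicator_of_mem hy, Set.indicator_of_mem hy, mul_one]
      · rw [hf, Set.indicator_of_notMem hy, Set.indicator_of_notMem hy, mul_zero]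
    rw [fourierCoeff_def, e, integral_indicator (measurableSet_singleton x), integral_singleton,
      norm_smul, norm_tpow, mul_one, Real.norm_of_nonneg measureReal_nonneg]
  have h := (tendsto_fourierCoeff_atTop hfi).norm
  simp only [hn, norm_zero] at h
  exact (measureReal_eq_zero_iff).1 (tendsto_nhds_unique tendsto_const_nhds h)

theorem ae_tpow_one_ne (a : ℂ) : ∀ᵐ x ∂circMeasure, tpow 1 x ≠ a := by
  have hs : {x : Circ | tpow 1 x = a}.Subsingleton := by
    intro x hx y hy
    have h : tpow 1 x = tpow 1 y := Eq.trans hx (Eq.symm hy)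
    simp only [tpow, fourier_one] at h
    exact injective_toCircle one_ne_zero (Circle.coe_injective h)
  rw [ae_iff]
  simp only [ne_eq, not_not]
  rcases hs.eq_empty_or_singleton with h | ⟨x, h⟩
  · rw [h, measure_empty]
  · rw [h, circMeasure_singleton]

theorem one_add_tpow_neg_one (x : Circ) : 1 + tpow (-1) x = tpow (-1) x * (tpow 1 x + 1) := by
  rw [mul_add, ← tpow_add, mul_one, show (-1 + 1 : ℤ) = 0 by norm_num, tpow_zero]

theorem one_sub_tpow_neg_one (x : Circ) : 1 - tpow (-1) x = tpow (-1) x * (tpow 1 x - 1) := by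
  rw [mul_sub, ← tpow_add, mul_one, show (-1 + 1 : ℤ) = 0 by norm_num, tpow_zero]

theorem ae_one_add_ne : ∀ᵐ x ∂circMeasure, 1 + tpow (-1) x ≠ 0 := by
  filter_upwards [ae_tpow_one_ne (-1)] with x hx
  rw [one_add_tpow_neg_one]
  exact mul_ne_zero (tpow_ne_zero _ _) fun h => hx (eq_neg_of_add_eq_zero_left h)

theorem ae_one_sub_ne : ∀ᵐ x ∂circMeasure, 1 - tpow (-1) x ≠ 0 := by
  filter_upwards [ae_tpow_one_ne 1] with x hx
  rw [one_sub_tpow_neg_one]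
  exact mul_ne_zero (tpow_ne_zero _ _) (sub_ne_zero.2 hx)

theorem IsUnitLinfty.ae_ne_zero {φ : Circ → ℂ} (hφ : IsUnitLinfty φ) :
    ∀ᵐ x ∂circMeasure, φ x ≠ 0 := by
  obtain ⟨ψ, _, h⟩ := hφ.2
  filter_upwards [h] with x hx h0
  rw [h0, zero_mul] at hx
  exact zero_ne_one hx

theorem memConjHardy_iff {f : Circ → ℂ} : MemConjHardy p f ↔
    MemLp f p circMeasure ∧ ∀ n : ℤ, 0 < n → fourierCoeff f n = 0 := by
  constructor
  · rintro ⟨h1, h2⟩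
    refine ⟨by simpa using memLp_conj h1, fun n hn => ?_⟩
    have := h2 (-n) (by omega)
    rwa [fourierCoeff_conj, neg_neg, map_eq_zero] at this
  · rintro ⟨h1, h2⟩
    refine ⟨memLp_conj h1, fun n hn => ?_⟩
    rw [fourierCoeff_conj, h2 _ (by omega), map_zero]

theorem MemConjHardy.congr {f g : Circ → ℂ} (h : MemConjHardy p f) (hfg : f =ᵐ[circMeasure] g) :
    MemConjHardy p g := by
  rw [memConjHardy_iff] at h ⊢
  exact ⟨(memLp_congr_ae hfg).1 h.1, fun n hn => by rw [← fourierCoeff_congr hfg, h.2 n hn]⟩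

theorem flip_congr {f g : Circ → ℂ} (h : f =ᵐ[circMeasure] g) :
    flip f =ᵐ[circMeasure] flip g := by
  filter_upwards [ae_neg h] with x hx
  simp only [flip, hx]

theorem flip_flip (f : Circ → ℂ) : flip (flip f) = f := by
  funext x
  simp only [flip, neg_neg, tpow_neg_arg]
  rw [← mul_assoc, ← tpow_add]
  simp [-fourier_apply, tpow_zero]

theorem flip_add (f g : Circ → ℂ) (x : Circ) :
    flip (fun y => f y + g y) x = flip f x + flip g x := by
  simp only [flip, mul_add]

theorem flip_add_flip (f : Circ → ℂ) (x : Circ) :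
    flip (fun y => f y + flip f y) x = f x + flip f x := by
  rw [flip_add, flip_flip, add_comm]

/-- The flip `J` as an operator on `L^p`. -/
noncomputable def flipCLM (p : ℝ≥0∞) [Fact (1 ≤ p)] :
    Lp ℂ p circMeasure →L[ℂ] Lp ℂ p circMeasure :=
  (mulCLM p (memLp_of_continuous (continuous_tpow (-1)) ∞)).comp (negCLM p)

variable [Fact (1 ≤ p)]

theorem coeFn_flipCLM (f : Lp ℂ p circMeasure) : flipCLM p f =ᵐ[circMeasure] flip f := by
  filter_upwards [coeFn_mulCLM (memLp_of_continuous (continuous_tpow (-1)) ∞) (negCLM p f),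
    coeFn_negCLM f] with x h1 h2
  rw [flipCLM, ContinuousLinearMap.comp_apply, h1, h2, flip]

theorem mem_LpJ_iff {f : Lp ℂ p circMeasure} :
    f ∈ LpJ p ↔ ∀ᵐ x ∂circMeasure, flip f x = f x := Iff.rfl

theorem mem_Hardy_iff {f : Lp ℂ p circMeasure} :
    f ∈ Hardy p ↔ ∀ n : ℤ, n < 0 → fourierCoeff f n = 0 :=
  ⟨fun h => h.2, fun h => ⟨Lp.memLp f, h⟩⟩

instance : CompleteSpace (Hardy p) := by
  refine IsClosed.completeSpace_coe (hs := ?_)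
  have : ((Hardy p : Submodule ℂ (Lp ℂ p circMeasure)) : Set (Lp ℂ p circMeasure)) =
      ⋂ n : ℤ, ⋂ _ : n < 0, {f | coeffCLM p n f = 0} := by
    ext f
    simp only [SetLike.mem_coe, mem_Hardy_iff, Set.mem_iInter, Set.mem_ofPred_eq, coeffCLM_apply]
  rw [this]
  exact isClosed_iInter fun n => isClosed_iInter fun _ =>
    isClosed_eq (coeffCLM p n).continuous continuous_const

theorem LpJ_fourierCoeff {h : Lp ℂ p circMeasure} (hh : h ∈ LpJ p) (n : ℤ) :
    fourierCoeff h (-n - 1) = fourierCoeff h n := by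
  rw [← fourierCoeff_flip, fourierCoeff_congr (mem_LpJ_iff.1 hh)]

/-- The Riesz projection as an operator from `L^p` onto `H^p`. -/
theorem exists_rieszCLM_hardy (hp1 : 1 < p) (hp : p < ∞) :
    ∃ P : Lp ℂ p circMeasure →L[ℂ] Hardy p, ∀ f : Lp ℂ p circMeasure,
      IsRieszProjection f (P f : Lp ℂ p circMeasure) := by
  obtain ⟨P, hP⟩ := exists_rieszCLM hp1 hp
  refine ⟨P.codRestrict (Hardy p) fun f => mem_Hardy_iff.2 fun n hn => ?_, hP⟩
  rw [(hP f).2.2, if_neg (not_le.2 hn)]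

theorem IsToeplitz.unique {φ : Circ → ℂ} {T T' : Hardy p →L[ℂ] Hardy p} (h : IsToeplitz φ T)
    (h' : IsToeplitz φ T') : T' = T := by
  ext1 f
  exact Subtype.ext (Lp.ext ((h' f).unique (h f)))

theorem IsHankel.unique {φ : Circ → ℂ} {T T' : Hardy p →L[ℂ] Hardy p} (h : IsHankel φ T)
    (h' : IsHankel φ T') : T' = T := by
  ext1 f
  exact Subtype.ext (Lp.ext ((h' f).unique (h f)))

theorem existsUnique_isToeplitz (hp1 : 1 < p) (hp : p < ∞) {φ : Circ → ℂ}
    (hφ : MemLp φ ∞ circMeasure) : ∃! T : Hardy p →L[ℂ] Hardy p, IsToeplitz φ T := by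
  obtain ⟨P, hP⟩ := exists_rieszCLM_hardy hp1 hp
  have h : IsToeplitz φ ((P.comp (mulCLM p hφ)).comp (Hardy p).subtypeL) := fun f =>
    (hP (mulCLM p hφ f)).congr (coeFn_mulCLM hφ (f : Lp ℂ p circMeasure)) .rfl
  exact ⟨_, h, fun T' h' => h.unique h'⟩

theorem existsUnique_isHankel (hp1 : 1 < p) (hp : p < ∞) {φ : Circ → ℂ}
    (hφ : MemLp φ ∞ circMeasure) : ∃! T : Hardy p →L[ℂ] Hardy p, IsHankel φ T := by
  obtain ⟨P, hP⟩ := exists_rieszCLM_hardy hp1 hp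
  have h : IsHankel φ ((P.comp ((mulCLM p hφ).comp (flipCLM p))).comp (Hardy p).subtypeL) :=
    fun f => (hP (mulCLM p hφ (flipCLM p f))).congr (by
      filter_upwards [coeFn_mulCLM hφ (flipCLM p f), coeFn_flipCLM (f : Lp ℂ p circMeasure)]
        with x h1 h2
      rw [h1, h2]) .rfl
  exact ⟨_, h, fun T' h' => h.unique h'⟩

/-- `T(φ) + H(φ)` is `f ↦ P (φ (I + J) f)`. -/
theorem fourierCoeff_toeplitz_add_hankel {φ : Circ → ℂ} {T H : Hardy p →L[ℂ] Hardy p}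
    (hT : IsToeplitz φ T) (hH : IsHankel φ H) (f : Hardy p) {n : ℤ} (hn : 0 ≤ n) :
    fourierCoeff (((T + H) f : Hardy p) : Lp ℂ p circMeasure) n =
      fourierCoeff (fun x => φ x * ((f : Lp ℂ p circMeasure) x +
        flip (f : Lp ℂ p circMeasure) x)) n := by
  have e : (((T + H) f : Hardy p) : Lp ℂ p circMeasure) =
      (T f : Lp ℂ p circMeasure) + (H f : Lp ℂ p circMeasure) := rfl
  rw [e, ← coeffCLM_apply, map_add, coeffCLM_apply, coeffCLM_apply, (hT f).2.2, (hH f).2.2,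
    if_pos hn, if_pos hn, ← fourierCoeff_add' (hT f).1 (hH f).1]
  simp only [mul_add]

/-- The analytic part `f` of a function `h` with `J h = h` satisfies `(I + J) f = h`. -/
theorem LpJ_eq_add_flip {h f : Lp ℂ p circMeasure} (hh : h ∈ LpJ p)
    (hf : IsRieszProjection h f) : h =ᵐ[circMeasure] fun x => f x + flip f x := by
  refine ae_eq_of_fourierCoeff hf.1 (hf.2.1.add (integrable_flip hf.2.1)) fun n => ?_
  rw [fourierCoeff_add' hf.2.1 (integrable_flip hf.2.1), fourierCoeff_flip, hf.2.2, hf.2.2]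
  rcases lt_or_ge n 0 with h0 | h0
  · rw [if_neg (by omega), if_pos (by omega), LpJ_fourierCoeff hh, zero_add]
  · rw [if_pos h0, if_neg (by omega), add_zero]

end ToeplitzHankel

/-! ### From a factorization to the inverse operator -/

section FactorizationToInverse

variable {p q : ℝ≥0∞} [Fact (1 ≤ p)] [ENNReal.HolderConjugate p q]

/-- A function `κ` is purely coanalytic if `(1 + t⁻¹) κ` is: its coefficients with nonnegative
index alternate, and tend to `0` by the Riemann–Lebesgue lemma. -/
theorem fourierCoeff_eq_zero_of_one_add_mul {κ : Circ → ℂ} (hκ : Integrable κ circMeasure)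
    (h : ∀ n : ℤ, 0 ≤ n → fourierCoeff (fun x => (1 + tpow (-1) x) * κ x) n = 0) {n : ℤ}
    (hn : 0 ≤ n) : fourierCoeff κ n = 0 := by
  have h1 : ∀ m : ℤ, 0 ≤ m → ‖fourierCoeff κ (m + 1)‖ = ‖fourierCoeff κ m‖ := by
    intro m hm
    have := h m hm
    simp only [add_mul, one_mul] at this
    rw [fourierCoeff_add' hκ (integrable_tpow_mul hκ (-1)), fourierCoeff_tpow_mul,
      sub_neg_eq_add] at this
    rw [eq_neg_of_add_eq_zero_right this, norm_neg]
  have h2 : ∀ k : ℕ, ‖fourierCoeff κ (n + k)‖ = ‖fourierCoeff κ n‖ := by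
    intro k
    induction k with
    | zero => simp
    | succ k ih => rw [Nat.cast_succ, ← add_assoc, h1 _ (by omega), ih]
  have h3 := (tendsto_fourierCoeff_atTop hκ).norm
  have h4 := h3.comp (tendsto_add_atTop_nat n.toNat)
  have h5 : Tendsto (fun _ : ℕ => ‖fourierCoeff κ n‖) atTop (𝓝 ‖(0 : ℂ)‖) := by
    refine h4.congr fun k => ?_
    simp only [Function.comp_apply]
    rw [← h2 k]
    congr 2
    push_cast
    rw [Int.toNat_of_nonneg hn]
    ring
  rw [norm_zero] at h5
  exact norm_eq_zero.1 (tendsto_nhds_unique tendsto_const_nhds h5)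

/-- The formal inverse is a right inverse: if `H = φ₀⁻¹ (I + J) P φ₋⁻¹ f` belongs to `L^p`, then
`P (φ H) = P f`, because `f - φ H = φ₋ (φ₋⁻¹ f - (I + J) P φ₋⁻¹ f)` is purely coanalytic. -/
theorem fourierCoeff_mul_formalInverse (hp1 : 1 < p) (hp : p < ∞) {φ φm φ₀ f u H : Circ → ℂ}
    (hφ : MemLp φ ∞ circMeasure)
    (hfac : ∀ᵐ x ∂circMeasure, φ x = φm x * φ₀ x) (hm0 : ∀ᵐ x ∂circMeasure, φm x ≠ 0)
    (h00 : ∀ᵐ x ∂circMeasure, φ₀ x ≠ 0)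
    (hm : MemConjHardy p (fun x => (1 + tpow (-1) x) * φm x)) (hf : MemLp f p circMeasure)
    (hH : MemLp H p circMeasure) (hv : MemLp (fun x => (φm x)⁻¹ * f x) q circMeasure)
    (hu : MemLp u q circMeasure) (huv : IsRieszProjection (fun x => (φm x)⁻¹ * f x) u)
    (hHu : ∀ᵐ x ∂circMeasure, H x = (φ₀ x)⁻¹ * (u x + flip u x)) {n : ℤ} (hn : 0 ≤ n) :
    fourierCoeff (fun x => φ x * H x) n = fourierCoeff f n := by
  have hm' := memConjHardy_iff.1 hm
  have hφH : MemLp (fun x => φ x * H x) p circMeasure := MemLp.mul (p := ∞) (q := p) hH hφ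
  have hpi := (Fact.out : 1 ≤ p)
  have hfi := hf.integrable hpi
  have hφHi := hφH.integrable hpi
  have hκi : Integrable (fun x => f x - φ x * H x) circMeasure := hfi.sub hφHi
  have hz : MemLp (fun x => (φm x)⁻¹ * f x - (u x + flip u x)) q circMeasure :=
    hv.sub (hu.add (memLp_flip hu))
  have hzc : ∀ n : ℤ, -1 < n →
      fourierCoeff (fun x => (φm x)⁻¹ * f x - (u x + flip u x)) n = 0 := by
    intro n hn
    have h1 : Integrable (fun x => u x + flip u x) circMeasure :=
      huv.2.1.add (integrable_flip huv.2.1)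
    rw [fourierCoeff_sub' huv.1 h1, fourierCoeff_add' huv.2.1 (integrable_flip huv.2.1),
      fourierCoeff_flip, huv.2.2, huv.2.2, if_pos (by omega), if_neg (by omega), add_zero, sub_self]
  have hprod : (fun x => (1 + tpow (-1) x) * (f x - φ x * H x)) =ᵐ[circMeasure]
      fun x => ((1 + tpow (-1) x) * φm x) * ((φm x)⁻¹ * f x - (u x + flip u x)) := by
    filter_upwards [hfac, hm0, h00, hHu] with x h1 h2 h3 h4
    rw [h1, h4]
    field_simp
  have hκ : fourierCoeff (fun x => f x - φ x * H x) n = 0 := by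
    refine fourierCoeff_eq_zero_of_one_add_mul hκi (fun m hm1 => ?_) hn
    rw [fourierCoeff_congr hprod, fourierCoeff_mul_of_le hp1 hp hm'.1 hz hm'.2 hzc
      (by omega), if_neg (by omega)]
  rw [fourierCoeff_sub' hfi hφHi] at hκ
  exact (sub_eq_zero.1 hκ).symm

/-- If `φ` factors, multiplication by `φ` followed by `P` is injective on `L^p_J`: for `h` in the
kernel, `b = (1 - t⁻¹) φ₀ h` is purely coanalytic and `b(t⁻¹) = -t² b(t)`, which forces `b = 0`. -/
theorem eq_zero_of_mem_LpJ (hp1 : 1 < p) (hp : p < ∞) {φ φm φ₀ : Circ → ℂ}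
    (hφ : MemLp φ ∞ circMeasure)
    (hfac : ∀ᵐ x ∂circMeasure, φ x = φm x * φ₀ x) (hm0 : ∀ᵐ x ∂circMeasure, φm x ≠ 0)
    (h00 : ∀ᵐ x ∂circMeasure, φ₀ x ≠ 0)
    (hmi : MemConjHardy q (fun x => (1 - tpow (-1) x) * (φm x)⁻¹)) (he : IsEven φ₀)
    {h : Lp ℂ p circMeasure} (hh : h ∈ LpJ p)
    (hc : ∀ n : ℤ, 0 ≤ n → fourierCoeff (fun x => φ x * h x) n = 0) : h = 0 := by
  have hmi' := memConjHardy_iff.1 hmi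
  have hw : MemLp (fun x => φ x * h x) p circMeasure :=
    MemLp.mul (p := ∞) (q := p) (Lp.memLp h) hφ
  set b : Circ → ℂ := fun x => (φ x * h x) * ((1 - tpow (-1) x) * (φm x)⁻¹) with hb
  have hbi : Integrable b circMeasure := integrable_mul_of_memLp hw hmi'.1
  have hbc : ∀ n : ℤ, 0 ≤ n → fourierCoeff b n = 0 := fun n hn => by
    rw [hb, fourierCoeff_mul_of_le hp1 hp hw hmi'.1 (M := -1) (N := 0)
      (fun m hm => hc m (by omega)) hmi'.2 (by omega), if_neg (by omega)]
  have hb0 : ∀ᵐ x ∂circMeasure, b x = (1 - tpow (-1) x) * (φ₀ x * h x) := by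
    filter_upwards [hfac, hm0] with x h1 h2
    rw [hb]
    simp only [h1]
    field_simp
  have hsym : (fun x => b (-x)) =ᵐ[circMeasure] fun x => -(tpow 2 x * b x) := by
    filter_upwards [hb0, ae_neg hb0, he, mem_LpJ_iff.1 hh] with x h1 h2 h3 h4
    rw [h1, h2, h3, ← h4, flip, tpow_neg_arg]
    have e1 : tpow 2 x = tpow 1 x * tpow 1 x := tpow_add 1 1 x
    have e2 : tpow 1 x * tpow (-1) x = 1 := tpow_mul_neg 1 x
    rw [neg_neg, e1]
    linear_combination (φ₀ x * (h : Circ → ℂ) (-x)) * (tpow 1 x - 1 - tpow 1 x * tpow (-1) x) * e2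
  have hbr : ∀ n : ℤ, fourierCoeff b (-n) = -fourierCoeff b (n - 2) := fun n => by
    rw [← fourierCoeff_neg_arg, fourierCoeff_congr hsym, fourierCoeff_neg', fourierCoeff_tpow_mul]
  have hball : ∀ n, fourierCoeff b n = 0 := by
    intro n
    rcases le_or_gt 0 n with h0 | h0
    · exact hbc n h0
    have h1 := hbr (-n)
    rw [neg_neg] at h1
    rcases eq_or_ne n (-1) with h2 | h2
    · subst h2
      norm_num at h1
      exact self_eq_neg.1 h1
    · rw [h1, hbc _ (by omega), neg_zero]
  refine Lp.ext ?_
  filter_upwards [ae_eq_zero_of_fourierCoeff hbi hball, hb0, h00, ae_one_sub_ne,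
    Lp.coeFn_zero ℂ p circMeasure] with x h1 h2 h3 h4 h5
  rw [h5, Pi.zero_apply]
  rw [h1, Pi.zero_apply] at h2
  exact ((mul_eq_zero.1 h2.symm).resolve_left h4 |> mul_eq_zero.1).resolve_left h3

/-- A bounded functional that vanishes on `(1 - t⁻¹) t ^ n` for all `n` is zero. -/
theorem functional_eq_zero_of_vanish (r : ℝ≥0∞) [ENNReal.HolderConjugate p r]
    (hp1 : 1 < p) (hp : p < ∞) {l : Lp ℂ p circMeasure →L[ℂ] ℂ}
    (h : ∀ n : ℤ, l (trigLp p (Finsupp.single n 1 - Finsupp.single (n - 1) 1)) = 0) : l = 0 := by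
  obtain ⟨g, hg, hl⟩ := exists_memLp_representation (q := r) hp1 hp l
  have hlm : ∀ n : ℤ, l (trigLp p (Finsupp.single n 1)) = fourierCoeff g (-n) := fun n => by
    rw [hl, fourierCoeff_def, neg_neg]
    refine integral_congr_ae ?_
    filter_upwards [coeFn_monomial p n] with x hx
    rw [hx]
  have hr1 : 1 < r := holderConjugate_one_lt (p := p) hp
  have hstep : ∀ n : ℤ, fourierCoeff g (n + 1) = fourierCoeff g n := fun n => by
    have := h (-n)
    rw [map_sub, map_sub, hlm, hlm, sub_eq_zero] at this
    rw [neg_neg] at this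
    rw [this]
    congr 1
    ring
  have hadd : ∀ (n : ℤ) (k : ℕ), fourierCoeff g (n + k) = fourierCoeff g n := by
    intro n k
    induction k with
    | zero => simp
    | succ k ih => rw [Nat.cast_succ, ← add_assoc, hstep, ih]
  have h0 : fourierCoeff g 0 = 0 := by
    refine tendsto_nhds_unique ?_ (tendsto_fourierCoeff_atTop (hg.integrable hr1.le))
    refine tendsto_const_nhds.congr fun k => ?_
    rw [← hadd 0 k, zero_add]
  refine clm_ext_monomial hp.ne fun n => ?_
  rw [hlm, _root_.zero_apply]
  rcases le_total 0 (-n) with h1 | h1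
  · rw [← h0, ← hadd 0 (-n).toNat]
    congr 1
    rw [Int.toNat_of_nonneg h1, zero_add]
  · rw [← h0, ← hadd (-n) n.toNat, Int.toNat_of_nonneg (by omega)]
    congr 1
    ring

/-- An asymmetric factorization with index `0` makes `T(φ) + H(φ)` invertible. -/
theorem isUnit_of_admitsAsymmetricFactorization (hp1 : 1 < p) (hp : p < ∞) {φ : Circ → ℂ}
    (hφ : IsUnitLinfty φ) {T H : Hardy p →L[ℂ] Hardy p} (hT : IsToeplitz φ T)
    (hH : IsHankel φ H) (hfact : AdmitsAsymmetricFactorization p q φ 0) : IsUnit (T + H) := by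
  obtain ⟨φm, φ₀, hA⟩ := hfact
  have hq1 : 1 < q := holderConjugate_one_lt (p := p) hp
  have hqt : q < ∞ := (ENNReal.HolderConjugate.lt_top_iff_one_lt q p).2 hp1
  have : Fact (1 ≤ q) := ⟨hq1.le⟩
  have hfac : ∀ᵐ x ∂circMeasure, φ x = φm x * φ₀ x := by
    filter_upwards [hA.eq] with x hx
    rw [hx, tpow_zero, mul_one]
  have hm0 : ∀ᵐ x ∂circMeasure, φm x ≠ 0 := by
    filter_upwards [hfac, hφ.ae_ne_zero] with x h1 h2 h3
    rw [h3, zero_mul] at h1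
    exact h2 h1
  have h00 : ∀ᵐ x ∂circMeasure, φ₀ x ≠ 0 := by
    filter_upwards [hfac, hφ.ae_ne_zero] with x h1 h2 h3
    rw [h3, mul_zero] at h1
    exact h2 h1
  have heven : IsEven φ₀ := by
    unfold IsEven
    filter_upwards [hA.even.2, ae_tpow_one_ne 1] with x h1 h2
    have e : ‖1 - tpow 1 (-x)‖ = ‖1 - tpow 1 x‖ := by
      rw [tpow_neg_arg, one_sub_tpow_neg_one, norm_mul, norm_tpow, one_mul, norm_sub_rev]
    rw [e] at h1
    refine mul_left_cancel₀ ?_ h1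
    rw [ne_eq, ofReal_eq_zero, norm_eq_zero, sub_eq_zero]
    exact fun h => h2 h.symm
  obtain ⟨P, hP⟩ := exists_rieszCLM_hardy hp1 hp
  obtain ⟨Q, hQ⟩ := exists_rieszCLM (p := q) hq1 hqt
  obtain ⟨B, hB⟩ := hA.bounded
  rw [ContinuousLinearMap.isUnit_iff_bijective]
  constructor
  · rw [injective_iff_map_eq_zero]
    intro f hf
    let h : Lp ℂ p circMeasure := (f : Lp ℂ p circMeasure) + flipCLM p f
    have hh : h =ᵐ[circMeasure] fun x => (f : Lp ℂ p circMeasure) x +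
        flip (f : Lp ℂ p circMeasure) x := by
      filter_upwards [Lp.coeFn_add (f : Lp ℂ p circMeasure) (flipCLM p f),
        coeFn_flipCLM (f : Lp ℂ p circMeasure)] with x h1 h2
      rw [h1, Pi.add_apply, h2]
    have hJ : h ∈ LpJ p := by
      rw [mem_LpJ_iff]
      filter_upwards [flip_congr hh, hh] with x h1 h2
      rw [h1, h2, flip_add_flip]
    have hz : h = 0 := by
      refine eq_zero_of_mem_LpJ hp1 hp hφ.1 hfac hm0 h00 hA.minus_inv heven hJ fun n hn => ?_
      have h1 := fourierCoeff_toeplitz_add_hankel hT hH f hn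
      rw [hf] at h1
      rw [fourierCoeff_congr (g := fun x => φ x * ((f : Lp ℂ p circMeasure) x +
        flip (f : Lp ℂ p circMeasure) x)) (hh.mono fun x hx => by simp only [hx]), ← h1]
      exact map_zero (coeffCLM p n)
    refine Subtype.ext (Lp_ext_fourierCoeff fun n => ?_)
    rcases lt_or_ge n 0 with hn | hn
    · rw [mem_Hardy_iff.1 f.2 n hn]
      exact (map_zero (coeffCLM p n)).symm
    · have h1 : fourierCoeff h n = fourierCoeff (f : Lp ℂ p circMeasure) n := by
        rw [fourierCoeff_congr hh, fourierCoeff_add' (integrable_coe p _)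
          (integrable_flip (integrable_coe p _)), fourierCoeff_flip,
          mem_Hardy_iff.1 f.2 (-n - 1) (by omega), add_zero]
      rw [← h1, hz]
      rfl
  · -- `P φ B` is the identity on `X₁`, hence everywhere.
    have hBP : ∀ (y : Lp ℂ p circMeasure) (n : ℤ), 0 ≤ n →
        fourierCoeff (fun x => φ x * (B y : Lp ℂ p circMeasure) x) n = fourierCoeff y n := by
      intro y n hn
      have h0 : (coeffCLM p n).comp ((mulCLM p hφ.1).comp ((LpJ p).subtypeL.comp B)) -
          coeffCLM p n = 0 := by
        refine functional_eq_zero_of_vanish q hp1 hp fun m => ?_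
        set f := trigLp p (Finsupp.single m 1 - Finsupp.single (m - 1) 1) with hfdef
        have hf : ∀ᵐ x ∂circMeasure, f x = (1 - tpow (-1) x) * (fourier m : C(Circ, ℂ)) x := by
          filter_upwards [coeFn_trigLp p (Finsupp.single m 1 - Finsupp.single (m - 1) 1)]
            with x hx
          rw [hfdef, hx, map_sub, ContinuousMap.sub_apply, trig_single, trig_single, one_mul,
            one_mul, sub_eq_neg_add m 1, tpow_add]
          ring
        obtain ⟨u, hu, hBu⟩ := hB (fourier m) (Submodule.subset_span ⟨m, rfl⟩) f hf
        have hv : MemLp (fun x => (φm x)⁻¹ * f x) q circMeasure := by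
          refine (memLp_congr_ae ?_).1 (memLp_tpow_mul (memConjHardy_iff.1 hA.minus_inv).1 m)
          filter_upwards [hf] with x hx
          rw [hx]
          ring
        have huq : MemLp u q circMeasure := by
          refine (memLp_congr_ae ?_).1 (Lp.memLp (Q hv.toLp))
          exact ((hQ hv.toLp).congr hv.coeFn_toLp .rfl).unique hu
        have := fourierCoeff_mul_formalInverse hp1 hp hφ.1 hfac hm0 h00 hA.minus
          (Lp.memLp f) (Lp.memLp _) hv huq hu hBu hn
        rw [_root_.sub_apply, sub_eq_zero, ContinuousLinearMap.comp_apply, coeffCLM_apply,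
          coeffCLM_apply, ← this]
        exact fourierCoeff_congr (coeFn_mulCLM hφ.1 _) n
      have h1 := congrArg (fun L : Lp ℂ p circMeasure →L[ℂ] ℂ => L y) h0
      simp only [_root_.sub_apply, _root_.zero_apply, sub_eq_zero] at h1
      rw [← coeffCLM_apply p n y, ← h1, ContinuousLinearMap.comp_apply, coeffCLM_apply]
      exact (fourierCoeff_congr (coeFn_mulCLM hφ.1 _) n).symm
    intro y
    refine ⟨P (B y), Subtype.ext (Lp_ext_fourierCoeff fun n => ?_)⟩
    rcases lt_or_ge n 0 with hn | hn
    · rw [mem_Hardy_iff.1 y.2 n hn, mem_Hardy_iff.1 (Subtype.property _) n hn]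
    · rw [fourierCoeff_toeplitz_add_hankel hT hH _ hn, ← hBP y n hn]
      refine fourierCoeff_congr ?_ n
      filter_upwards [LpJ_eq_add_flip (B y).2 (hP (B y))] with x hx
      rw [hx]

end FactorizationToInverse

/-! ### From the inverse operator to a factorization -/

section InverseToFactorization

variable {p q : ℝ≥0∞} [Fact (1 ≤ p)]

/-- If `T(φ) + H(φ)` is invertible, `N = (I + J) (T(φ) + H(φ))⁻¹ P` maps `y ∈ L^p` to the unique
`h ∈ L^p_J` with `P (φ h) = P y`. -/
theorem exists_inverse_operator (hp1 : 1 < p) (hp : p < ∞) {φ : Circ → ℂ}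
    {T H : Hardy p →L[ℂ] Hardy p} (hT : IsToeplitz φ T) (hH : IsHankel φ H)
    (hunit : IsUnit (T + H)) :
    ∃ N : Lp ℂ p circMeasure →L[ℂ] LpJ p,
      (∀ (y : Lp ℂ p circMeasure) (n : ℤ), 0 ≤ n →
        fourierCoeff (fun x => φ x * (N y : Lp ℂ p circMeasure) x) n = fourierCoeff y n) ∧
      ∀ h ∈ LpJ p, ∀ y : Lp ℂ p circMeasure,
        (∀ n : ℤ, 0 ≤ n → fourierCoeff (fun x => φ x * h x) n = fourierCoeff y n) →
          (N y : Lp ℂ p circMeasure) = h := by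
  obtain ⟨P, hP⟩ := exists_rieszCLM_hardy hp1 hp
  obtain ⟨U, hSU, hUS⟩ := isUnit_iff_exists.1 hunit
  let S : Lp ℂ p circMeasure →L[ℂ] Lp ℂ p circMeasure :=
    (ContinuousLinearMap.id ℂ _ + flipCLM p).comp ((Hardy p).subtypeL.comp (U.comp P))
  have hS : ∀ y, S y =ᵐ[circMeasure] fun x => (U (P y) : Lp ℂ p circMeasure) x +
      flip (U (P y) : Lp ℂ p circMeasure) x := by
    intro y
    filter_upwards [Lp.coeFn_add (U (P y) : Lp ℂ p circMeasure) (flipCLM p (U (P y))),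
      coeFn_flipCLM (U (P y) : Lp ℂ p circMeasure)] with x h1 h2
    rw [← h2]
    exact h1
  have hSJ : ∀ y, S y ∈ LpJ p := fun y => by
    rw [mem_LpJ_iff]
    filter_upwards [flip_congr (hS y), hS y] with x h1 h2
    rw [h1, h2, flip_add_flip]
  refine ⟨S.codRestrict (LpJ p) hSJ, fun y n hn => ?_, fun h hh y hy => ?_⟩
  · have h1 := fourierCoeff_toeplitz_add_hankel hT hH (U (P y)) hn
    have h2 : (T + H) (U (P y)) = P y :=
      congrArg (fun L : Hardy p →L[ℂ] Hardy p => L (P y)) hSU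
    rw [h2, (hP y).2.2, if_pos hn] at h1
    rw [h1]
    exact fourierCoeff_congr ((hS y).mono fun x hx => congrArg (φ x * ·) hx) n
  · have hsplit := LpJ_eq_add_flip hh (hP h)
    have h1 : (T + H) (P h) = P y := by
      refine Subtype.ext (Lp_ext_fourierCoeff fun n => ?_)
      rcases lt_or_ge n 0 with hn | hn
      · rw [mem_Hardy_iff.1 (Subtype.property _) n hn, mem_Hardy_iff.1 (Subtype.property _) n hn]
      · rw [fourierCoeff_toeplitz_add_hankel hT hH (P h) hn, (hP y).2.2, if_pos hn, ← hy n hn]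
        exact (fourierCoeff_congr (hsplit.mono fun x hx => congrArg (φ x * ·) hx) n).symm
    have h2 : U (P y) = P h := by
      rw [← h1]
      exact congrArg (fun L : Hardy p →L[ℂ] Hardy p => L (P h)) hUS
    refine Lp.ext ((hS y).trans ?_)
    rw [h2]
    exact hsplit.symm

theorem monomial_add_flip_mem_LpJ (n : ℤ) :
    trigLp p (Finsupp.single n 1 + Finsupp.single (-n - 1) 1) ∈ LpJ p := by
  have h : trigLp p (Finsupp.single n 1 + Finsupp.single (-n - 1) 1) =ᵐ[circMeasure]
      fun x => tpow n x + tpow (-n - 1) x := by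
    filter_upwards [coeFn_trigLp p (Finsupp.single n 1 + Finsupp.single (-n - 1) 1)] with x hx
    rw [hx, map_add, ContinuousMap.add_apply, trig_single, trig_single, one_mul, one_mul]
  rw [mem_LpJ_iff]
  filter_upwards [flip_congr h, h] with x h1 h2
  have e1 : (-1 + -n : ℤ) = -n - 1 := by ring
  have e2 : (-1 + -(-n - 1) : ℤ) = n := by ring
  rw [h1, h2, flip, tpow_neg_arg, tpow_neg_arg, mul_add, ← tpow_add, ← tpow_add, e1, e2, add_comm]

theorem ae_neg_eq_of_fourierCoeff {k : Circ → ℂ} (hk : Integrable k circMeasure)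
    (h : ∀ n : ℤ, fourierCoeff k (-n) = -fourierCoeff k (n + 1)) :
    ∀ᵐ x ∂circMeasure, k (-x) = -(tpow (-1) x * k x) := by
  refine ae_eq_of_fourierCoeff (integrable_neg_arg hk) (integrable_tpow_mul hk (-1)).fun_neg
    fun n => ?_
  rw [fourierCoeff_neg_arg, fourierCoeff_neg', fourierCoeff_tpow_mul, h, sub_neg_eq_add]

variable [ENNReal.HolderConjugate p q]

/-- The dual counterpart of solving `P (φ h) = 1`: representing the functional `y ↦ -∫ (N y) φ t`
on `L^p` gives `g ∈ L^q` with nonpositive spectrum such that `k = φ (g + t)` annihilates `L^p_J`,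
that is, `k(t⁻¹) = -t⁻¹ k(t)`. -/
theorem exists_dual_solution (hp1 : 1 < p) (hp : p < ∞) {φ : Circ → ℂ}
    (hφ : MemLp φ ∞ circMeasure) {N : Lp ℂ p circMeasure →L[ℂ] LpJ p}
    (hN : ∀ h ∈ LpJ p, ∀ y : Lp ℂ p circMeasure,
      (∀ n : ℤ, 0 ≤ n → fourierCoeff (fun x => φ x * h x) n = fourierCoeff y n) →
        (N y : Lp ℂ p circMeasure) = h) :
    ∃ g : Circ → ℂ, MemLp g q circMeasure ∧ (∀ n : ℤ, 1 < n → fourierCoeff g n = 0) ∧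
      fourierCoeff g 1 = 1 ∧
      ∀ᵐ x ∂circMeasure, φ (-x) * g (-x) = -(tpow (-1) x * (φ x * g x)) := by
  have hq1 : 1 < q := holderConjugate_one_lt (p := p) hp
  have hqt : q < ∞ := (ENNReal.HolderConjugate.lt_top_iff_one_lt q p).2 hp1
  have : Fact (1 ≤ q) := ⟨hq1.le⟩
  have hφt : MemLp (fun x => φ x * tpow 1 x) q circMeasure :=
    MemLp.mul (p := ∞) (q := q) (memLp_of_continuous (continuous_tpow 1) q) hφ
  obtain ⟨g₀, hg₀, hrep⟩ := exists_memLp_representation (q := q) hp1 hp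
    (-((pairCLM p hφt).comp ((LpJ p).subtypeL.comp N)))
  have hmono : ∀ (n : ℤ) (k : Circ → ℂ),
      ∫ x, trigLp p (Finsupp.single n 1) x * k x ∂circMeasure = fourierCoeff k (-n) := fun n k => by
    rw [fourierCoeff_def, neg_neg]
    refine integral_congr_ae ?_
    filter_upwards [coeFn_monomial p n] with x hx
    rw [hx]
  have hg₀c : ∀ n : ℤ, 0 < n → fourierCoeff g₀ n = 0 := by
    intro n hn
    have h1 := hrep (trigLp p (Finsupp.single (-n) 1))
    have h2 : (N (trigLp p (Finsupp.single (-n) 1)) : Lp ℂ p circMeasure) = 0 := by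
      refine hN 0 (Submodule.zero_mem _) _ fun m hm => ?_
      rw [← coeffCLM_apply p m, coeffCLM_trigLp, Finsupp.single_apply, if_neg (by omega)]
      rw [fourierCoeff_congr (g := fun _ => (0 : ℂ))]
      · simp [fourierCoeff]
      · filter_upwards [Lp.coeFn_zero ℂ p circMeasure] with x hx
        rw [hx, Pi.zero_apply, mul_zero]
    rw [hmono, neg_neg] at h1
    rw [← h1, _root_.neg_apply, ContinuousLinearMap.comp_apply, ContinuousLinearMap.comp_apply,
      Submodule.subtypeL_apply, h2, map_zero, neg_zero]
  have hφg₀ : MemLp (fun x => φ x * g₀ x) q circMeasure := MemLp.mul (p := ∞) (q := q) hg₀ hφ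
  set g : Circ → ℂ := fun x => g₀ x + tpow 1 x with hg
  have ht : MemLp (tpow 1) q circMeasure := memLp_of_continuous (continuous_tpow 1) q
  have hgq : MemLp g q circMeasure := hg₀.add ht
  have hgc : ∀ n, fourierCoeff g n = fourierCoeff g₀ n + if n = 1 then 1 else 0 := fun n => by
    rw [hg, fourierCoeff_add' (hg₀.integrable hq1.le) (ht.integrable hq1.le), fourierCoeff_tpow]
  have hk : MemLp (fun x => φ x * g x) q circMeasure := MemLp.mul (p := ∞) (q := q) hgq hφ
  -- `k = φ g` annihilates `L^p_J`.
  have hann : ∀ h ∈ LpJ p, ∫ x, h x * (φ x * g x) ∂circMeasure = 0 := by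
    intro h hh
    have h1 := hrep (mulCLM p hφ h)
    have h2 : (N (mulCLM p hφ h) : Lp ℂ p circMeasure) = h :=
      hN h hh _ fun n _ => (fourierCoeff_congr (coeFn_mulCLM hφ h) n).symm
    rw [_root_.neg_apply, ContinuousLinearMap.comp_apply, ContinuousLinearMap.comp_apply,
      Submodule.subtypeL_apply, h2, pairCLM_apply] at h1
    have h3 : ∫ x, mulCLM p hφ h x * g₀ x ∂circMeasure =
        ∫ x, h x * (φ x * g₀ x) ∂circMeasure := by
      refine integral_congr_ae ?_
      filter_upwards [coeFn_mulCLM hφ h] with x hx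
      rw [hx]
      ring
    rw [h3] at h1
    have h4 : (fun x => h x * (φ x * g x)) =
        fun x => h x * (φ x * g₀ x) + h x * (φ x * tpow 1 x) := by
      funext x
      simp only [hg]
      ring
    rw [h4, integral_add (integrable_mul_of_memLp (Lp.memLp h) hφg₀)
      (integrable_mul_of_memLp (Lp.memLp h) hφt), ← h1]
    ring
  have hki : Integrable (fun x => φ x * g x) circMeasure := hk.integrable hq1.le
  have hkc : ∀ n : ℤ, fourierCoeff (fun x => φ x * g x) (-n) =
      -fourierCoeff (fun x => φ x * g x) (n + 1) := by
    intro n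
    have h1 := hann _ (monomial_add_flip_mem_LpJ (p := p) n)
    rw [← pairCLM_apply hk, map_add, map_add, pairCLM_apply, pairCLM_apply, hmono, hmono] at h1
    rw [eq_neg_of_add_eq_zero_left h1]
    congr 2
    ring
  refine ⟨g, hgq, fun n hn => ?_, ?_, ?_⟩
  · rw [hgc, hg₀c n (by omega), if_neg (by omega), add_zero]
  · rw [hgc, hg₀c 1 one_pos, if_pos rfl, zero_add]
  · have h1 := ae_neg_eq_of_fourierCoeff (k := fun x => φ x * g x) hki hkc
    filter_upwards [h1] with x hx
    exact hx

/-- The solutions of the two dual problems are inverse to each other up to the factor `t - t⁻¹`: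
the product is odd, with top term `t`. -/
theorem mul_dual_solution (hp1 : 1 < p) (hp : p < ∞) {φ g : Circ → ℂ}
    (hφ : MemLp φ ∞ circMeasure) {h₀ : Lp ℂ p circMeasure} (hh₀ : h₀ ∈ LpJ p)
    (hc : ∀ n : ℤ, 0 ≤ n → fourierCoeff (fun x => φ x * h₀ x) n = if n = 0 then 1 else 0)
    (hg : MemLp g q circMeasure) (hg1 : ∀ n : ℤ, 1 < n → fourierCoeff g n = 0)
    (hg2 : fourierCoeff g 1 = 1)
    (hk : ∀ᵐ x ∂circMeasure, φ (-x) * g (-x) = -(tpow (-1) x * (φ x * g x))) :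
    ∀ᵐ x ∂circMeasure, h₀ x * (φ x * g x) = tpow 1 x - tpow (-1) x := by
  have hφh : MemLp (fun x => φ x * h₀ x) p circMeasure :=
    MemLp.mul (p := ∞) (q := p) (Lp.memLp h₀) hφ
  set w : Circ → ℂ := fun x => φ x * h₀ x * g x with hw
  have hwi : Integrable w circMeasure := integrable_mul_of_memLp hφh hg
  have hodd : (fun x => w (-x)) =ᵐ[circMeasure] fun x => -w x := by
    filter_upwards [hk, mem_LpJ_iff.1 hh₀] with x h1 h2
    simp only [hw]
    rw [← h2, flip]
    linear_combination (h₀ : Circ → ℂ) (-x) * h1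
  have hwn : ∀ n, fourierCoeff w (-n) = -fourierCoeff w n := fun n => by
    rw [← fourierCoeff_neg_arg, fourierCoeff_congr hodd, fourierCoeff_neg']
  have hw1 : ∀ n : ℤ, 1 ≤ n → fourierCoeff w n = if n = 1 then 1 else 0 := by
    intro n hn
    rw [hw, fourierCoeff_mul_of_le hp1 hp hφh hg (M := 0) (N := 1)
      (fun m hm => by rw [hc m hm.le, if_neg hm.ne']) hg1 (by omega), hc 0 le_rfl, hg2]
    simp
  have hw0 : fourierCoeff w 0 = 0 := by
    have := hwn 0
    rw [neg_zero] at this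
    exact self_eq_neg.1 this
  have hti : ∀ n, Integrable (tpow n) circMeasure := fun n =>
    memLp_one_iff_integrable.1 (memLp_of_continuous (continuous_tpow n) 1)
  have := ae_eq_of_fourierCoeff hwi ((hti 1).sub (hti (-1))) fun n => by
    have h1 := fourierCoeff_sub' (hti 1) (hti (-1)) n
    refine Eq.trans ?_ h1.symm
    rw [fourierCoeff_tpow, fourierCoeff_tpow]
    rcases lt_trichotomy n 0 with h | h | h
    · rw [← neg_neg n, hwn, hw1 _ (by omega), neg_neg, if_neg (by omega : ¬ n = 1), zero_sub]
      by_cases h' : n = -1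
      · simp [h']
      · rw [if_neg (by omega), if_neg h']
    · rw [h, hw0]
      simp
    · rw [hw1 n (by omega), if_neg (by omega : ¬ n = -1), sub_zero]
  filter_upwards [this] with x hx
  rw [Pi.sub_apply] at hx
  rw [← hx]
  simp only [hw]
  ring

/-- `t ^ j + t ^ (-j - 1)` vanishes at `t = -1`, and so is bounded by a multiple of `1 + t⁻¹`. -/
theorem norm_tpow_add_flip_le (j : ℕ) (x : Circ) :
    ‖tpow j x + tpow (-j - 1) x‖ ≤ (2 * j + 1) * ‖1 + tpow (-1) x‖ := by
  induction j with
  | zero => simp [-fourier_apply, tpow_zero]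
  | succ j ih =>
    have e : tpow ((j + 1 : ℕ) : ℤ) x + tpow (-((j + 1 : ℕ) : ℤ) - 1) x =
        -(tpow j x + tpow (-j - 1) x) + tpow (j + 1) x * (1 + tpow (-1) x) +
          tpow (-j - 1) x * (1 + tpow (-1) x) := by
      rw [mul_add, mul_add, ← tpow_add, ← tpow_add, mul_one, mul_one]
      have e1 : (j : ℤ) + 1 + -1 = j := by ring
      have e2 : -((j + 1 : ℕ) : ℤ) - 1 = -(j : ℤ) - 1 + -1 := by push_cast; ring
      rw [e1, e2, Nat.cast_succ]
      ring
    rw [e]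
    refine norm_add₃_le.trans ?_
    rw [norm_neg, norm_mul, norm_mul, norm_tpow, norm_tpow]
    push_cast
    linarith

/-- On `X₁` the operator `N` is given by the formal inverse. For `f = (1 - t⁻¹) r` the projection
`u` of `φ₋⁻¹ f` is a polynomial and `u + J u` vanishes at `t = -1`; hence `φ₀⁻¹ (u + J u)` is in
`L^p`, although `φ₀⁻¹` need not be. -/
theorem isFormalInverse_of_inverse_operator (hp1 : 1 < p) (hp : p < ∞) {φ φm φ₀ : Circ → ℂ}
    (hφ : MemLp φ ∞ circMeasure)
    (hfac : ∀ᵐ x ∂circMeasure, φ x = φm x * φ₀ x) (hm0 : ∀ᵐ x ∂circMeasure, φm x ≠ 0)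
    (h00 : ∀ᵐ x ∂circMeasure, φ₀ x ≠ 0)
    (hm : MemConjHardy p (fun x => (1 + tpow (-1) x) * φm x))
    (hmi : MemConjHardy q (fun x => (1 - tpow (-1) x) * (φm x)⁻¹)) (he : IsEven φ₀)
    {h₀ : Lp ℂ p circMeasure} (hh₀ : ∀ᵐ x ∂circMeasure, (1 + tpow (-1) x) * (φ₀ x)⁻¹ = h₀ x)
    {N : Lp ℂ p circMeasure →L[ℂ] LpJ p}
    (hN : ∀ h ∈ LpJ p, ∀ y : Lp ℂ p circMeasure,
      (∀ n : ℤ, 0 ≤ n → fourierCoeff (fun x => φ x * h x) n = fourierCoeff y n) →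
        (N y : Lp ℂ p circMeasure) = h)
    (c : ℤ →₀ ℂ) {f : Lp ℂ p circMeasure}
    (hf : ∀ᵐ x ∂circMeasure, f x = (1 - tpow (-1) x) * trig c x) :
    IsFormalInverse φm φ₀ f (N f : Lp ℂ p circMeasure) := by
  have hq1 : 1 < q := holderConjugate_one_lt (p := p) hp
  have hmi' := memConjHardy_iff.1 hmi
  have hve : (fun x => trig c x * ((1 - tpow (-1) x) * (φm x)⁻¹)) =ᵐ[circMeasure]
      fun x => (φm x)⁻¹ * f x := by
    filter_upwards [hf] with x hx
    rw [hx]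
    ring
  have hv : MemLp (fun x => (φm x)⁻¹ * f x) q circMeasure :=
    (memLp_congr_ae hve).1
      (MemLp.mul (p := ∞) (q := q) hmi'.1 (memLp_of_continuous (trig c).continuous ∞))
  set v : ℤ → ℂ := fourierCoeff fun x => (φm x)⁻¹ * f x with hvdef
  obtain ⟨K, hK⟩ := c.support.exists_le
  have hvK : ∀ n, K < n → v n = 0 := fun n hn => by
    rw [hvdef, ← fourierCoeff_congr hve, fourierCoeff_mul_of_le hp1 hp
      (memLp_of_continuous (trig c).continuous p) hmi'.1 (M := K) (N := 0) (fun m hm => ?_)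
      hmi'.2 (by omega), if_neg (by omega)]
    rw [fourierCoeff_trig]
    by_contra h
    exact absurd (hK m (Finsupp.mem_support_iff.2 h)) (not_le.2 hm)
  let d : ℤ →₀ ℂ := Finsupp.onFinset (Finset.Icc 0 K) (fun n => if 0 ≤ n then v n else 0)
    fun n hn => by
      by_cases h : 0 ≤ n
      · rw [if_pos h] at hn
        exact Finset.mem_Icc.2 ⟨h, not_lt.1 fun h' => hn (hvK n h')⟩
      · exact absurd (if_neg h) hn
  have hd : ∀ n, d n = if 0 ≤ n then v n else 0 := fun n => rfl
  set u : Circ → ℂ := ⇑(trig d) with hu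
  have huc : Continuous u := (trig d).continuous
  have hR : IsRieszProjection (fun x => (φm x)⁻¹ * f x) u :=
    ⟨hv.integrable hq1.le, integrable_continuousMap _, fun n => by rw [hu, fourierCoeff_trig, hd]⟩
  have hsum : ∀ x, u x + flip u x = d.sum fun n a => a * (tpow n x + tpow (-n - 1) x) := by
    intro x
    rw [flip, hu, trig_apply, trig_apply, Finsupp.mul_sum, ← Finsupp.sum_add]
    refine Finsupp.sum_congr fun n _ => ?_
    rw [tpow_neg_arg, sub_eq_neg_add, tpow_add]
    ring
  set C : ℝ := d.sum fun n a => ‖a‖ * (2 * n.toNat + 1) with hC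
  have hbound : ∀ x, ‖u x + flip u x‖ ≤ C * ‖1 + tpow (-1) x‖ := by
    intro x
    rw [hsum, hC, Finsupp.sum, Finsupp.sum, Finset.sum_mul]
    refine (norm_sum_le _ _).trans (Finset.sum_le_sum fun n hn => ?_)
    have hn0 : 0 ≤ n := by
      by_contra h
      rw [Finsupp.mem_support_iff, hd, if_neg h] at hn
      exact hn rfl
    rw [norm_mul, mul_assoc]
    refine mul_le_mul_of_nonneg_left ?_ (norm_nonneg _)
    have := norm_tpow_add_flip_le n.toNat x
    rwa [Int.toNat_of_nonneg hn0] at this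
  have hH₀ : (fun x => (φ₀ x)⁻¹ * (u x + flip u x)) =ᵐ[circMeasure]
      fun x => h₀ x * ((1 + tpow (-1) x)⁻¹ * (u x + flip u x)) := by
    filter_upwards [hh₀, ae_one_add_ne] with x h1 h2
    rw [← h1]
    field_simp
  have hHm : MemLp (fun x => (φ₀ x)⁻¹ * (u x + flip u x)) p circMeasure := by
    rw [memLp_congr_ae hH₀]
    have hfl : Measurable (flip u) :=
      ((continuous_tpow (-1)).mul (huc.comp continuous_neg)).measurable
    refine (Lp.memLp h₀).of_le_mul (c := C) ((Lp.memLp h₀).1.mul ?_) ?_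
    · refine Measurable.aestronglyMeasurable ?_
      exact ((continuous_const.add (continuous_tpow (-1))).measurable.inv).mul
        (huc.measurable.add hfl)
    · filter_upwards [ae_one_add_ne] with x hx
      rw [norm_mul, norm_mul, norm_inv, mul_comm C]
      refine mul_le_mul_of_nonneg_left ?_ (norm_nonneg _)
      rw [inv_mul_le_iff₀ (norm_pos_iff.2 hx), mul_comm]
      exact hbound x
  have hJ : hHm.toLp ∈ LpJ p := by
    rw [mem_LpJ_iff]
    filter_upwards [flip_congr hHm.coeFn_toLp, hHm.coeFn_toLp, he] with x h1 h2 h3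
    rw [h1, h2, ← flip_add_flip u x]
    simp only [flip, h3]
    ring
  have hNf : (N f : Lp ℂ p circMeasure) = hHm.toLp := by
    refine hN _ hJ f fun n hn => ?_
    rw [fourierCoeff_congr (g := fun x => φ x * ((φ₀ x)⁻¹ * (u x + flip u x)))
      (hHm.coeFn_toLp.mono fun x hx => congrArg (φ x * ·) hx)]
    exact fourierCoeff_mul_formalInverse hp1 hp hφ hfac hm0 h00 hm (Lp.memLp f) hHm hv
      (memLp_of_continuous huc q) hR (Eventually.of_forall fun _ => rfl) hn
  refine ⟨u, hR, ?_⟩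
  rw [hNf]
  exact hHm.coeFn_toLp

/-- If `T(φ) + H(φ)` is invertible, the solution `h₀` of `P (φ h₀) = 1` in `L^p_J` gives the
factorization with `φ₋ = φ h₀ / (1 + t⁻¹)` and `φ₀ = (1 + t⁻¹) / h₀`; integrability of the inverse
factors is supplied by the dual solution `g`, since `h₀ φ g = t - t⁻¹`. -/
theorem admitsAsymmetricFactorization_of_isUnit (hp1 : 1 < p) (hp : p < ∞) {φ : Circ → ℂ}
    (hφ : IsUnitLinfty φ) {T H : Hardy p →L[ℂ] Hardy p} (hT : IsToeplitz φ T)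
    (hH : IsHankel φ H) (hunit : IsUnit (T + H)) : AdmitsAsymmetricFactorization p q φ 0 := by
  have hq1 : 1 < q := holderConjugate_one_lt (p := p) hp
  obtain ⟨N, hN1, hN2⟩ := exists_inverse_operator hp1 hp hT hH hunit
  obtain ⟨g, hg, hg1, hg2, hgk⟩ := exists_dual_solution (q := q) hp1 hp hφ.1 hN2
  set h₀ : Lp ℂ p circMeasure := (N (trigLp p (Finsupp.single 0 1)) : Lp ℂ p circMeasure) with hh₀
  have hJ : h₀ ∈ LpJ p := (N (trigLp p (Finsupp.single 0 1))).2
  have hc : ∀ n : ℤ, 0 ≤ n → fourierCoeff (fun x => φ x * h₀ x) n = if n = 0 then 1 else 0 := by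
    intro n hn
    rw [hN1 _ n hn, ← coeffCLM_apply, coeffCLM_trigLp, Finsupp.single_apply]
    simp only [eq_comm]
  have hprod := mul_dual_solution hp1 hp hφ.1 hJ hc hg hg1 hg2 hgk
  have hφh : MemLp (fun x => φ x * h₀ x) p circMeasure :=
    MemLp.mul (p := ∞) (q := p) (Lp.memLp h₀) hφ.1
  have hk : MemLp (fun x => φ x * g x) q circMeasure := MemLp.mul (p := ∞) (q := q) hg hφ.1
  have htt : ∀ x, tpow 1 x - tpow (-1) x = tpow 1 x * (1 - tpow (-1) x) * (1 + tpow (-1) x) := by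
    intro x
    linear_combination (tpow (-1) x) * tpow_mul_neg 1 x
  have hh0 : ∀ᵐ x ∂circMeasure, h₀ x ≠ 0 := by
    filter_upwards [hprod, ae_one_add_ne, ae_one_sub_ne] with x h1 h2 h3 h4
    rw [h4, zero_mul, htt] at h1
    exact mul_ne_zero (mul_ne_zero (tpow_ne_zero 1 x) h3) h2 h1.symm
  set φm : Circ → ℂ := fun x => φ x * h₀ x / (1 + tpow (-1) x) with hφm
  set φ₀ : Circ → ℂ := fun x => (1 + tpow (-1) x) / h₀ x with hφ₀
  have hfac : ∀ᵐ x ∂circMeasure, φ x = φm x * φ₀ x := by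
    filter_upwards [hh0, ae_one_add_ne] with x h1 h2
    simp only [hφm, hφ₀]
    field_simp
  have hm0 : ∀ᵐ x ∂circMeasure, φm x ≠ 0 := by
    filter_upwards [hh0, ae_one_add_ne, hφ.ae_ne_zero] with x h1 h2 h3
    exact div_ne_zero (mul_ne_zero h3 h1) h2
  have h00 : ∀ᵐ x ∂circMeasure, φ₀ x ≠ 0 := by
    filter_upwards [hh0, ae_one_add_ne] with x h1 h2
    exact div_ne_zero h2 h1
  have heven : IsEven φ₀ := by
    unfold IsEven
    filter_upwards [mem_LpJ_iff.1 hJ, hh0, ae_neg hh0] with x h1 h2 h3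
    simp only [hφ₀]
    rw [div_eq_div_iff h3 h2, ← h1, flip, tpow_neg_arg, neg_neg]
    linear_combination (h₀ : Circ → ℂ) (-x) * tpow_mul_neg 1 x
  have hm : MemConjHardy p (fun x => (1 + tpow (-1) x) * φm x) := by
    refine MemConjHardy.congr (f := fun x => φ x * h₀ x) (memConjHardy_iff.2 ⟨hφh, fun n hn => ?_⟩)
      ?_
    · rw [hc n hn.le, if_neg hn.ne']
    · filter_upwards [ae_one_add_ne] with x h2
      simp only [hφm]
      field_simp
  have hmi : MemConjHardy q (fun x => (1 - tpow (-1) x) * (φm x)⁻¹) := by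
    refine MemConjHardy.congr (f := fun x => tpow (-1) x * g x)
      (memConjHardy_iff.2 ⟨memLp_tpow_mul hg _, fun n hn => ?_⟩) ?_
    · rw [fourierCoeff_tpow_mul, hg1 _ (by omega)]
    · filter_upwards [hprod, ae_one_add_ne, hh0, hφ.ae_ne_zero] with x h1 h2 h3 h4
      rw [htt] at h1
      simp only [hφm]
      rw [inv_div, mul_div_assoc', eq_div_iff (mul_ne_zero h4 h3)]
      linear_combination tpow (-1) x * h1 +
        (1 - tpow (-1) x) * (1 + tpow (-1) x) * tpow_mul_neg 1 x
  have hφ₀m : AEStronglyMeasurable φ₀ circMeasure := by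
    have h1 : AEMeasurable φ₀ circMeasure :=
      (continuous_const.add (continuous_tpow (-1))).measurable.aemeasurable.div
        (Lp.aestronglyMeasurable h₀).aemeasurable
    exact h1.aestronglyMeasurable
  have hnorm : ∀ n : ℤ, Continuous fun x : Circ => ((‖1 - tpow n x‖ : ℝ) : ℂ) := fun n =>
    continuous_ofReal.comp (continuous_const.sub (continuous_tpow n)).norm
  have hnorm' : ∀ n : ℤ, Continuous fun x : Circ => ((‖1 + tpow n x‖ : ℝ) : ℂ) := fun n =>
    continuous_ofReal.comp (continuous_const.add (continuous_tpow n)).norm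
  have e1 : ∀ x, ‖1 - tpow (-1) x‖ = ‖1 - tpow 1 x‖ := fun x => by
    rw [one_sub_tpow_neg_one, norm_mul, norm_tpow, one_mul, norm_sub_rev]
  have e2 : ∀ x, ‖1 + tpow (-1) x‖ = ‖1 + tpow 1 x‖ := fun x => by
    rw [one_add_tpow_neg_one, norm_mul, norm_tpow, one_mul, add_comm]
  refine ⟨φm, φ₀, ?_, hm, hmi, ⟨?_, ?_⟩, ⟨?_, ?_⟩, N, fun r hr f hf => ?_⟩
  · filter_upwards [hfac] with x hx
    rw [hx, tpow_zero, mul_one]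
  · refine hk.of_le ((hnorm 1).aestronglyMeasurable.mul hφ₀m) ?_
    filter_upwards [hprod, hh0, ae_one_add_ne] with x h1 h2 h3
    rw [htt] at h1
    have h4 : φ x * g x = tpow 1 x * (1 - tpow (-1) x) * φ₀ x := by
      simp only [hφ₀]
      rw [mul_div_assoc', eq_div_iff h2, ← h1]
      ring
    rw [h4, norm_mul, norm_mul, norm_mul, norm_tpow, one_mul, e1, norm_real,
      Real.norm_of_nonneg (norm_nonneg _)]
  · unfold IsEven
    filter_upwards [heven] with x hx
    rw [hx, tpow_neg_arg, e1]
  · refine (Lp.memLp h₀).of_le ((hnorm' 1).aestronglyMeasurable.mul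
      hφ₀m.aemeasurable.inv.aestronglyMeasurable) ?_
    filter_upwards [ae_one_add_ne] with x h1
    simp only [hφ₀]
    rw [norm_mul, norm_real, Real.norm_of_nonneg (norm_nonneg _), inv_div, norm_div, e2]
    rw [← norm_ne_zero_iff, e2] at h1
    rw [mul_div_cancel₀ _ h1]
  · unfold IsEven
    filter_upwards [heven] with x hx
    rw [hx, tpow_neg_arg, e2]
  · obtain ⟨c, rfl⟩ : ∃ c, trig c = r := by
      change r ∈ trigPoly at hr
      rw [← range_trig] at hr
      exact hr
    refine isFormalInverse_of_inverse_operator hp1 hp hφ.1 hfac hm0 h00 hm hmi heven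
      (h₀ := h₀) ?_ hN2 c hf
    filter_upwards [ae_one_add_ne] with x h1
    simp only [hφ₀]
    field_simp

end InverseToFactorization

end AsymFact

theorem theoremt4p3 (p q : ℝ≥0∞) [Fact (1 ≤ p)] (hp : 1 < p) (hp_top : p < ∞)
    (hpq : p⁻¹ + q⁻¹ = 1) (φ : AsymFact.Circ → ℂ) (hφ : AsymFact.IsUnitLinfty φ) :
    (∃! T : AsymFact.Hardy p →L[ℂ] AsymFact.Hardy p, AsymFact.IsToeplitz φ T) ∧
    (∃! H : AsymFact.Hardy p →L[ℂ] AsymFact.Hardy p, AsymFact.IsHankel φ H) ∧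
    ∀ T H : AsymFact.Hardy p →L[ℂ] AsymFact.Hardy p,
      AsymFact.IsToeplitz φ T → AsymFact.IsHankel φ H →
        (IsUnit (T + H) ↔ AsymFact.AdmitsAsymmetricFactorization p q φ 0) := by
  have : ENNReal.HolderConjugate p q := ENNReal.holderConjugate_iff.2 hpq
  exact ⟨AsymFact.existsUnique_isToeplitz hp hp_top hφ.1,
    AsymFact.existsUnique_isHankel hp hp_top hφ.1, fun T H hT hH =>
      ⟨AsymFact.admitsAsymmetricFactorization_of_isUnit hp hp_top hφ hT hH,
        AsymFact.isUnit_of_admitsAsymmetricFactorization hp hp_top hφ hT hH⟩⟩
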